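/- Let $f_0(z)=\exp\!\big(z/(1-z)\big)$ and $f_1(z)=e^{x}E_1(x)$ with $x=1/(1-z)$, where $E_1(x)=\int_x^\infty \frac{e^{-t}}{t}\,dt$ is the exponential integral (principal branch); both functions are analytic in the disk $|z|<1$. Let $a_n=[z^n]f_0(z)$ and $b_n=[z^n]f_1(z)$ be their Maclaurin coefficients. Put $$\mu(h)=\frac1h-\frac1{e^h-1}-\frac12$$ (extended by $\mu(0)=0$, so that $\mu$ is analytic at $0$), and for $m\ge 0$ $$c_m=(-1)^m\sum_{j=0}^m [h^{m-j}]\exp(\mu(h))\;\frac{(m-2j+3/2)_{2j}}{4^j\,j!},$$ where $(x)_k=x(x+1)\cdots(x+k-1)$. Then, as $n\to\infty$ through the positive integers, $$a_n\sim\frac{e^{2\sqrt n}}{2n^{3/4}\sqrt{\pi e}}\sum_{m\ge0}c_m n^{-m/2}\qquad\text{and}\qquad b_n\sim-\frac{\sqrt{\pi e}}{n^{3/4}e^{2\sqrt n}}\sum_{m\ge0}(-1)^m c_m n^{-m/2}$$ as asymptotic series in the sense of Poincaré; that is, for every integer $M\ge 0$, $$a_n=\frac{e^{2\sqrt n}}{2n^{3/4}\sqrt{\pi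 e}}\Big(\sum_{m=0}^{M-1}c_m n^{-m/2}+O(n^{-M/2})\Big),\qquad b_n=-\frac{\sqrt{\pi e}}{n^{3/4}e^{2\sqrt n}}\Big(\sum_{m=0}^{M-1}(-1)^m c_m n^{-m/2}+O(n^{-M/2})\Big),$$ where the implied constants depend only on $M$. In particular, $b_n$ is of exact order $e^{-2\sqrt n}n^{-3/4}$, i.e. $|b_n|$ lies between two positive constant multiples of $e^{-2\sqrt n}n^{-3/4}$ for all sufficiently large $n$ (Salvy's conjecture). -/

import Mathlib

namespace StretchedExp

/-- The exponential integral `E₁(x) = ∫_x^∞ e^{-t}/t dt` (principal branch), the path of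
integration being the horizontal ray `t = x + s`, `0 < s < ∞`. For real `x > 0` this is the
usual real integral over `(x, ∞)`. -/
noncomputable def E₁ (x : ℂ) : ℂ :=
  ∫ s in Set.Ioi (0 : ℝ), Complex.exp (-(x + s)) / (x + s)

/-- `f₀(z) = exp(z/(1-z))`. -/
noncomputable def f₀ (z : ℂ) : ℂ := Complex.exp (z / (1 - z))

/-- `f₁(z) = e^x E₁(x)` with `x = 1/(1-z)`. -/
noncomputable def f₁ (z : ℂ) : ℂ := Complex.exp (1 / (1 - z)) * E₁ (1 / (1 - z))

/-- The Maclaurin coefficient `[z^n] f(z) = f⁽ⁿ⁾(0)/n!`. -/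
noncomputable def maclaurinCoeff {𝕜 : Type*} [NontriviallyNormedField 𝕜] (f : 𝕜 → 𝕜) (n : ℕ) : 𝕜 :=
  iteratedDeriv n f 0 / (n.factorial : 𝕜)

/-- `a_n = [z^n] f₀(z)`. -/
noncomputable def a (n : ℕ) : ℂ := maclaurinCoeff f₀ n

/-- `b_n = [z^n] f₁(z)`. -/
noncomputable def b (n : ℕ) : ℂ := maclaurinCoeff f₁ n

/-- `μ(h) = 1/h - 1/(e^h-1) - 1/2`, with the removable singularity at `h = 0` filled in by the
limit value `0`. -/
noncomputable def μ (h : ℝ) : ℝ :=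
  if h = 0 then 0 else h⁻¹ - (Real.exp h - 1)⁻¹ - 1 / 2

/-- `c_m = (-1)^m ∑_{j=0}^m [h^{m-j}] exp(μ(h)) · (m-2j+3/2)_{2j} / (4^j j!)`, where `(x)_k` is the
ascending factorial. -/
noncomputable def c (m : ℕ) : ℝ :=
  (-1) ^ m * ∑ j ∈ Finset.range (m + 1),
    maclaurinCoeff (fun h : ℝ => Real.exp (μ h)) (m - j) *
      (ascPochhammer ℝ (2 * j)).eval ((m : ℝ) - 2 * (j : ℝ) + 3 / 2) /
        (4 ^ j * (j.factorial : ℝ))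

/-- `u_n ∼ g_n ∑_{m ≥ 0} γ_m n^{-m/2}` as an asymptotic series in the sense of Poincaré:
for every `M`, `u_n / g_n = ∑_{m < M} γ_m n^{-m/2} + O(n^{-M/2})` as `n → ∞`. -/
def HasAsymptoticSeries (u : ℕ → ℂ) (g : ℕ → ℝ) (γ : ℕ → ℝ) : Prop :=
  ∀ M : ℕ,
    (fun n : ℕ => u n / (g n : ℂ) -
        ((∑ m ∈ Finset.range M, γ m * (n : ℝ) ^ (-(m : ℝ) / 2) : ℝ) : ℂ))
      =O[Filter.atTop] (fun n : ℕ => (n : ℝ) ^ (-(M : ℝ) / 2))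

end StretchedExp

open MeasureTheory

namespace StretchedExp

/-! For n ≥ 1 put N = √n. Both coefficients are integrals of the same kind. Under z = e^{-h} one has
z/(1-z) = 1/(e^h-1), and Cauchy's formula becomes a_n = (2πi)⁻¹ ∮ exp(nh + 1/(e^h-1)) dh around h =
0. Writing e^x E₁(x) = ∫_0^∞ e^{-s}/(x+s) ds, expanding in z and putting s = 1/(e^h-1) gives b_n =
-∫_0^∞ exp(-nh - 1/(e^h-1)) dh.

Since 1/(e^h-1) = 1/h - 1/2 - μ(h), both integrands have their saddle near h = 1/N. With h =
N⁻¹e^{2iθ} and h = N⁻¹e^{2s} the exponents are exactly 2N - 4N sin²θ - 1/2 + μ(-h), as μ is odd, and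
-2N - 4N sinh²s + 1/2 + μ(h) (`a_eq_integral`, `b_eq_integral`). Expanding exp μ in powers of h, and
counting one more factor e^{2iθ} or e^{2s} from dh, leaves the Bessel integrals π e^{-2N} I_ν(2N)
and e^{2N} K_ν(2N) with ν = k+1.

Their expansions in 1/N have the same coefficients (ν-j+1/2)_{2j}/(4^j j!), with an extra sign
(-1)^j for I_ν (`exists_abs_integral_weight_cos_sub_le`, `exists_abs_integral_weight_exp_sub_le`).
Collecting the terms with k+j = m gives c_m for a and (-1)^m c_m for b
(`exists_norm_sub_sum_seriesCoeff_le`). The exact order of b_n then follows from c_0 = 1. -/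

/-! ### Expansion of cosh(2νs) in the functions sinh^{2j} s · cosh s -/

/-- The coefficients of `cosh (2 ν s) / cosh s` as a power series in `sinh s ^ 2`. -/
noncomputable def coshCoeff (ν : ℕ) : ℕ → ℝ
  | 0 => 1
  | j + 1 => (4 * (ν : ℝ) ^ 2 - (2 * j + 1) ^ 2) / ((2 * j + 1) * (2 * j + 2)) * coshCoeff ν j

/-- The error in truncating the expansion of `cosh (2 ν s)` in `sinh s ^ (2 j) * cosh s`. -/
noncomputable def coshRemainder (ν J : ℕ) (s : ℂ) : ℂ :=
  Complex.cosh (2 * ν * s) -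
    ∑ j ∈ Finset.range J, (coshCoeff ν j : ℂ) * (Complex.sinh s ^ (2 * j) * Complex.cosh s)

lemma coshCoeff_succ_mul (ν j : ℕ) :
    (coshCoeff ν (j + 1) : ℂ) * ((2 * j + 1) * (2 * j + 2)) =
      (4 * (ν : ℂ) ^ 2 - (2 * j + 1) ^ 2) * coshCoeff ν j := by
  have h : coshCoeff ν (j + 1) * ((2 * j + 1) * (2 * j + 2)) =
      (4 * (ν : ℝ) ^ 2 - (2 * j + 1) ^ 2) * coshCoeff ν j := by
    rw [coshCoeff]
    field_simp
  exact_mod_cast h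

/-- The derivative of `coshRemainder`. -/
noncomputable def coshRemainderDeriv (ν J : ℕ) (s : ℂ) : ℂ :=
  2 * ν * Complex.sinh (2 * ν * s) -
    ∑ j ∈ Finset.range J, (coshCoeff ν j : ℂ) *
      (2 * j * Complex.sinh s ^ (2 * j - 1) + (2 * j + 1) * Complex.sinh s ^ (2 * j + 1))

lemma hasDerivAt_sinh_pow_mul_cosh (j : ℕ) (s : ℂ) :
    HasDerivAt (fun s => Complex.sinh s ^ (2 * j) * Complex.cosh s)
      (2 * j * Complex.sinh s ^ (2 * j - 1) + (2 * j + 1) * Complex.sinh s ^ (2 * j + 1)) s := by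
  refine (((Complex.hasDerivAt_sinh s).pow (2 * j)).mul
    (Complex.hasDerivAt_cosh s)).congr_deriv ?_
  have hc := Complex.cosh_sq s
  rcases j with _ | j
  · simp
  · have : 2 * (j + 1) - 1 = 2 * j + 1 := by omega
    simp only [this, Pi.pow_apply]
    push_cast
    linear_combination (2 * (j + 1 : ℂ)) * Complex.sinh s ^ (2 * j + 1) * hc

lemma hasDerivAt_coshRemainder (ν J : ℕ) (s : ℂ) :
    HasDerivAt (coshRemainder ν J) (coshRemainderDeriv ν J s) s := by
  have h1 : HasDerivAt (fun s : ℂ => Complex.cosh (2 * ν * s))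
      (Complex.sinh (2 * ν * s) * (2 * ν * 1)) s :=
    ((hasDerivAt_id s).const_mul (2 * ν : ℂ)).ccosh
  refine (h1.sub (HasDerivAt.fun_sum (u := Finset.range J) fun j _ =>
    (hasDerivAt_sinh_pow_mul_cosh j s).const_mul (coshCoeff ν j : ℂ))).congr_deriv ?_
  rw [coshRemainderDeriv]
  ring

/-- The remainder R solves R'' = 4ν²R + κ sinh^{2J} s cosh s. The recursion for `coshCoeff` is
exactly the condition under which all forcing terms below the top one cancel. -/
lemma hasDerivAt_coshRemainderDeriv (ν J : ℕ) (s : ℂ) :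
    HasDerivAt (coshRemainderDeriv ν (J + 1))
      (4 * ν ^ 2 * coshRemainder ν (J + 1) s +
        (4 * ν ^ 2 - (2 * J + 1) ^ 2) * coshCoeff ν J * (Complex.sinh s ^ (2 * J) * Complex.cosh s))
      s := by
  have h1 : HasDerivAt (fun s : ℂ => 2 * ν * Complex.sinh (2 * ν * s))
      (2 * ν * (Complex.cosh (2 * ν * s) * (2 * ν * 1))) s :=
    (((hasDerivAt_id s).const_mul (2 * ν : ℂ)).csinh).const_mul _
  have h2 : ∀ j : ℕ, HasDerivAt (fun s : ℂ => (coshCoeff ν j : ℂ) *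
      (2 * j * Complex.sinh s ^ (2 * j - 1) + (2 * j + 1) * Complex.sinh s ^ (2 * j + 1)))
      ((coshCoeff ν j : ℂ) * (2 * j * (2 * j - 1) * Complex.sinh s ^ (2 * j - 2) +
        (2 * j + 1) ^ 2 * Complex.sinh s ^ (2 * j)) * Complex.cosh s) s := by
    intro j
    refine (((((Complex.hasDerivAt_sinh s).pow (2 * j - 1)).const_mul (2 * j : ℂ)).add
      (((Complex.hasDerivAt_sinh s).pow (2 * j + 1)).const_mul
        (2 * j + 1 : ℂ))).const_mul (coshCoeff ν j : ℂ)).congr_deriv ?_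
    rcases j with _ | j
    · simp
    · have h3 : 2 * (j + 1) - 1 = 2 * j + 1 := by omega
      have h4 : 2 * (j + 1) - 2 = 2 * j := by omega
      simp only [h3, h4, Nat.add_sub_cancel]
      push_cast
      ring
  refine (h1.sub (HasDerivAt.fun_sum (u := Finset.range (J + 1)) fun j _ => h2 j)).congr_deriv ?_
  rw [coshRemainder]
  induction J with
  | zero => simp [coshCoeff]; ring
  | succ J ih =>
    rw [Finset.sum_range_succ, Finset.sum_range_succ (n := J + 1)]
    have h4 : 2 * (J + 1) - 2 = 2 * J := by omega
    rw [h4]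
    push_cast
    linear_combination ih -
      Complex.sinh s ^ (2 * J) * Complex.cosh s * coshCoeff_succ_mul ν J

lemma norm_le_of_norm_deriv_le_pow {f f' : ℂ → ℂ} (hf : ∀ s, HasDerivAt f (f' s) s)
    (h0 : f 0 = 0) {C R : ℝ} {m : ℕ} (hC : 0 ≤ C) (h : ∀ s, ‖s‖ ≤ R → ‖f' s‖ ≤ C * ‖s‖ ^ m)
    {s : ℂ} (hs : ‖s‖ ≤ R) : ‖f s‖ ≤ C * ‖s‖ ^ (m + 1) := by
  have key := (convex_closedBall (0 : ℂ) ‖s‖).norm_image_sub_le_of_norm_hasDerivWithin_le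
    (f := f) (f' := f') (C := C * ‖s‖ ^ m) (x := 0) (y := s)
    (fun x _ => (hf x).hasDerivWithinAt) (fun x hx => ?_) (by simp) (by simp)
  · simpa [h0, pow_succ, mul_assoc] using key
  · have hx' : ‖x‖ ≤ ‖s‖ := by simpa using hx
    exact (h x (hx'.trans hs)).trans (by gcongr)

lemma exists_norm_sinh_le : ∃ C : ℝ, 0 ≤ C ∧ ∀ s : ℂ, ‖s‖ ≤ 2 →
    ‖Complex.sinh s‖ ≤ C * ‖s‖ ∧ ‖Complex.cosh s‖ ≤ C := by
  obtain ⟨C, hC⟩ := (isCompact_closedBall (0 : ℂ) 2).exists_bound_of_continuousOn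
    (f := Complex.cosh) (by fun_prop)
  have hC0 : 0 ≤ C := (norm_nonneg _).trans (hC 0 (by simp))
  refine ⟨C, hC0, fun s hs => ⟨?_, hC s (by simpa using hs)⟩⟩
  simpa using norm_le_of_norm_deriv_le_pow (m := 0) Complex.hasDerivAt_sinh Complex.sinh_zero hC0
    (fun s hs => by simpa using hC s (by simpa using hs)) hs

lemma coshRemainder_zero_right (ν J : ℕ) : coshRemainder ν (J + 1) 0 = 0 := by
  simp [coshRemainder, Finset.sum_range_succ', coshCoeff]

lemma coshRemainderDeriv_zero_right (ν J : ℕ) : coshRemainderDeriv ν J 0 = 0 := by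
  simp only [coshRemainderDeriv, mul_zero, Complex.sinh_zero, zero_sub, neg_eq_zero]
  refine Finset.sum_eq_zero fun j _ => ?_
  rcases j with _ | j
  · simp
  · have h3 : 2 * (j + 1) - 1 = 2 * j + 1 := by omega
    simp [h3]

/-- Bootstrap on the differential equation: a bound of order 2i on R bounds R'' to the same order,
because the forcing term has order 2J ≥ 2i. Two integrations from R(0) = R'(0) = 0 then raise the
order by two. -/
lemma exists_norm_coshRemainder_le_aux (ν J i : ℕ) (hi : i ≤ J) : ∃ C : ℝ, 0 ≤ C ∧
    ∀ s : ℂ, ‖s‖ ≤ 2 → ‖coshRemainder ν J s‖ ≤ C * ‖s‖ ^ (2 * i) := by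
  induction i with
  | zero =>
    have hcont : Continuous (coshRemainder ν J) :=
      continuous_iff_continuousAt.2 fun s => (hasDerivAt_coshRemainder ν J s).continuousAt
    obtain ⟨C, hC⟩ := (isCompact_closedBall (0 : ℂ) 2).exists_bound_of_continuousOn
      hcont.continuousOn
    exact ⟨C, (norm_nonneg _).trans (hC 0 (by simp)), fun s hs => by
      simpa using hC s (by simpa using hs)⟩
  | succ i ih =>
    obtain ⟨C, hC0, hC⟩ := ih (by omega)
    obtain ⟨B, hB0, hB⟩ := exists_norm_sinh_le
    obtain ⟨J, rfl⟩ : ∃ J', J = J' + 1 := ⟨J - 1, by omega⟩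
    set κ : ℂ := (4 * ν ^ 2 - (2 * J + 1) ^ 2) * coshCoeff ν J
    set A : ℝ := 4 * ν ^ 2 * C + ‖κ‖ * (B ^ (2 * J) * 2 ^ (2 * J - 2 * i) * B)
    have hA : 0 ≤ A := by positivity
    have h2 : ∀ s : ℂ, ‖s‖ ≤ 2 → ‖4 * ν ^ 2 * coshRemainder ν (J + 1) s +
        κ * (Complex.sinh s ^ (2 * J) * Complex.cosh s)‖ ≤ A * ‖s‖ ^ (2 * i) := by
      intro s hs
      have e1 : ‖s‖ ^ (2 * J) ≤ 2 ^ (2 * J - 2 * i) * ‖s‖ ^ (2 * i) := by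
        have : 2 * J = (2 * J - 2 * i) + 2 * i := by omega
        conv_lhs => rw [this, pow_add]
        gcongr
      calc _ ≤ ‖(4 * ν ^ 2 * coshRemainder ν (J + 1) s : ℂ)‖ +
            ‖κ * (Complex.sinh s ^ (2 * J) * Complex.cosh s)‖ := norm_add_le _ _
        _ = 4 * ν ^ 2 * ‖coshRemainder ν (J + 1) s‖ +
            ‖κ‖ * (‖Complex.sinh s‖ ^ (2 * J) * ‖Complex.cosh s‖) := by simp
        _ ≤ 4 * ν ^ 2 * (C * ‖s‖ ^ (2 * i)) + ‖κ‖ * ((B * ‖s‖) ^ (2 * J) * B) := by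
            gcongr
            · exact hC s hs
            · exact (hB s hs).1
            · exact (hB s hs).2
        _ = 4 * ν ^ 2 * (C * ‖s‖ ^ (2 * i)) + ‖κ‖ * (B ^ (2 * J) * ‖s‖ ^ (2 * J) * B) := by
            rw [mul_pow]
        _ ≤ 4 * ν ^ 2 * (C * ‖s‖ ^ (2 * i)) +
            ‖κ‖ * (B ^ (2 * J) * (2 ^ (2 * J - 2 * i) * ‖s‖ ^ (2 * i)) * B) := by gcongr
        _ = A * ‖s‖ ^ (2 * i) := by ring
    refine ⟨A, hA, fun s hs => ?_⟩
    exact norm_le_of_norm_deriv_le_pow (hasDerivAt_coshRemainder ν (J + 1))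
      (coshRemainder_zero_right ν J) hA (fun s hs => norm_le_of_norm_deriv_le_pow
        (hasDerivAt_coshRemainderDeriv ν J) (coshRemainderDeriv_zero_right ν (J + 1)) hA h2 hs) hs

lemma exists_norm_coshRemainder_le (ν J : ℕ) : ∃ C : ℝ, 0 ≤ C ∧
    ∀ s : ℂ, ‖s‖ ≤ 2 → ‖coshRemainder ν J s‖ ≤ C * ‖s‖ ^ (2 * J) :=
  exists_norm_coshRemainder_le_aux ν J J le_rfl

/-- This is the complex estimate at s = iθ, which lies in the disk because π/2 < 2. Jordan's
inequality |θ| ≤ (π/2)|sin θ| turns powers of θ into powers of sin θ. -/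
lemma exists_abs_cos_sub_le (ν J : ℕ) : ∃ C : ℝ, 0 ≤ C ∧ ∀ θ : ℝ, |θ| ≤ Real.pi / 2 →
    |Real.cos (2 * ν * θ) - ∑ j ∈ Finset.range J,
      coshCoeff ν j * ((-1) ^ j * (Real.sin θ ^ (2 * j) * Real.cos θ))| ≤
        C * Real.sin θ ^ (2 * J) := by
  obtain ⟨C, hC0, hC⟩ := exists_norm_coshRemainder_le ν J
  refine ⟨C * (Real.pi / 2) ^ (2 * J), by positivity, fun θ hθ => ?_⟩
  have h1 := hC (θ * Complex.I) (by
    have := Real.pi_lt_four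
    simp only [norm_mul, Complex.norm_real, Real.norm_eq_abs, Complex.norm_I, mul_one]
    linarith)
  have h2 : coshRemainder ν J (θ * Complex.I) =
      ((Real.cos (2 * ν * θ) - ∑ j ∈ Finset.range J,
      coshCoeff ν j * ((-1) ^ j * (Real.sin θ ^ (2 * j) * Real.cos θ)) : ℝ) : ℂ) := by
    rw [coshRemainder, ← mul_assoc, Complex.cosh_mul_I, Complex.cosh_mul_I, Complex.sinh_mul_I]
    push_cast
    congr 1
    refine Finset.sum_congr rfl fun j _ => ?_
    rw [mul_pow, pow_mul Complex.I, Complex.I_sq]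
    ring
  rw [h2, Complex.norm_real, Real.norm_eq_abs] at h1
  refine h1.trans ?_
  have h3 : |θ| ≤ Real.pi / 2 * |Real.sin θ| := by
    have := Real.mul_abs_le_abs_sin hθ
    have hp := Real.pi_pos
    calc |θ| = Real.pi / 2 * (2 / Real.pi * |θ|) := by field_simp
      _ ≤ _ := by gcongr
  have h4 : Real.sin θ ^ (2 * J) = |Real.sin θ| ^ (2 * J) := by
    rw [pow_mul, pow_mul, sq_abs]
  simp only [norm_mul, Complex.norm_real, Real.norm_eq_abs, Complex.norm_I, mul_one]
  rw [mul_assoc, h4, ← mul_pow]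
  gcongr

/-- For |s| ≤ 2 the local estimate and |s| ≤ |sinh s| suffice. For |s| ≥ 2 every term is bounded
separately, using e^{|s|} ≤ 3|sinh s|; the power 2(J+ν) is there to dominate cosh(2νs) and all the
subtracted terms at once. -/
lemma exists_abs_cosh_sub_le (ν J : ℕ) : ∃ C : ℝ, 0 ≤ C ∧ ∀ s : ℝ,
    |Real.cosh (2 * ν * s) - ∑ j ∈ Finset.range J,
      coshCoeff ν j * (Real.sinh s ^ (2 * j) * Real.cosh s)| ≤
        C * ((Real.sinh s ^ (2 * J) + Real.sinh s ^ (2 * (J + ν))) * Real.cosh s) := by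
  obtain ⟨C, hC0, hC⟩ := exists_norm_coshRemainder_le ν J
  set B := 3 ^ (2 * ν) + ∑ j ∈ Finset.range J, |coshCoeff ν j|
  refine ⟨C + B, by positivity, fun s => ?_⟩
  have hch := Real.one_le_cosh s
  have hsq : ∀ j, Real.sinh s ^ (2 * j) = |Real.sinh s| ^ (2 * j) := fun j => by
    rw [pow_mul, pow_mul, sq_abs]
  simp only [hsq]
  rcases le_total |s| 2 with hs | hs
  · have h1 := hC s (by simpa using hs)
    have h2 : coshRemainder ν J s =
        ((Real.cosh (2 * ν * s) - ∑ j ∈ Finset.range J,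
        coshCoeff ν j * (|Real.sinh s| ^ (2 * j) * Real.cosh s) : ℝ) : ℂ) := by
      simp only [← hsq]
      rw [coshRemainder]
      push_cast
      rfl
    rw [h2, Complex.norm_real, Real.norm_eq_abs] at h1
    have h3 : |s| ≤ |Real.sinh s| := by
      rw [Real.abs_sinh]; exact Real.self_le_sinh_iff.2 (abs_nonneg s)
    calc _ ≤ C * |s| ^ (2 * J) := by simpa using h1
      _ ≤ C * |Real.sinh s| ^ (2 * J) := by gcongr
      _ ≤ (C + B) * ((|Real.sinh s| ^ (2 * J) + |Real.sinh s| ^ (2 * (J + ν))) * 1) := by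
          rw [mul_one]
          gcongr
          · simp only [le_add_iff_nonneg_right]; positivity
          · simp only [le_add_iff_nonneg_right]; positivity
      _ ≤ _ := by gcongr
  · have h1 : 1 ≤ |Real.sinh s| := by
      rw [Real.abs_sinh]
      have := Real.self_le_sinh_iff.2 (abs_nonneg s)
      linarith
    have h2 : Real.cosh (2 * ν * s) ≤ (3 * |Real.sinh s|) ^ (2 * ν) := by
      have e1 : Real.cosh s ≤ 2 * |Real.sinh s| := by
        refine abs_le_of_sq_le_sq' ?_ (by positivity) |>.2
        rw [Real.cosh_sq, mul_pow, sq_abs]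
        have := one_le_pow₀ (n := 2) h1
        rw [sq_abs] at this
        linarith
      have e2 : Real.exp |s| ≤ 3 * |Real.sinh s| := by
        rw [← Real.cosh_add_sinh, ← Real.abs_sinh, Real.cosh_abs]
        linarith
      calc Real.cosh (2 * ν * s) = Real.cosh |2 * ν * s| := (Real.cosh_abs _).symm
        _ ≤ Real.exp |2 * ν * s| := by
            rw [← Real.cosh_add_sinh]
            have := Real.sinh_nonneg_iff.2 (abs_nonneg (2 * ν * s))
            linarith
        _ = Real.exp |s| ^ (2 * ν) := by
            rw [← Real.exp_nat_mul, abs_mul]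
            congr 1
            push_cast
            rw [abs_of_nonneg (by positivity : (0 : ℝ) ≤ 2 * ν)]
        _ ≤ _ := by gcongr
    calc _ ≤ |Real.cosh (2 * ν * s)| + |∑ j ∈ Finset.range J,
          coshCoeff ν j * (|Real.sinh s| ^ (2 * j) * Real.cosh s)| := abs_sub _ _
      _ ≤ (3 * |Real.sinh s|) ^ (2 * ν) + ∑ j ∈ Finset.range J,
          |coshCoeff ν j| * (|Real.sinh s| ^ (2 * (J + ν)) * Real.cosh s) := by
          gcongr
          · rwa [abs_of_pos (Real.cosh_pos _)]
          · refine (Finset.abs_sum_le_sum_abs _ _).trans (Finset.sum_le_sum fun j hj => ?_)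
            rw [abs_mul, abs_mul, abs_pow, abs_abs, abs_of_pos (Real.cosh_pos _)]
            have : j < J := Finset.mem_range.1 hj
            gcongr ?_ * (?_ * ?_)
            exact pow_le_pow_right₀ h1 (by omega)
      _ ≤ 3 ^ (2 * ν) * (|Real.sinh s| ^ (2 * (J + ν)) * Real.cosh s) + ∑ j ∈ Finset.range J,
          |coshCoeff ν j| * (|Real.sinh s| ^ (2 * (J + ν)) * Real.cosh s) := by
          gcongr
          rw [mul_pow]
          gcongr
          calc |Real.sinh s| ^ (2 * ν) ≤ |Real.sinh s| ^ (2 * (J + ν)) * 1 := by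
                rw [mul_one]; exact pow_le_pow_right₀ h1 (by omega)
            _ ≤ _ := by gcongr
      _ = B * (|Real.sinh s| ^ (2 * (J + ν)) * Real.cosh s) := by
          rw [← Finset.sum_mul]; ring
      _ ≤ _ := by
          gcongr
          · simpa using hC0
          · simp only [le_add_iff_nonneg_left]; positivity

/-! ### Bessel coefficients and Gaussian moments -/

/-- The coefficient `(ν - j + 1/2)_{2j} / (4^j j!)` of the Bessel function expansions. -/
noncomputable def besselCoeff (ν j : ℕ) : ℝ :=
  (ascPochhammer ℝ (2 * j)).eval ((ν : ℝ) - j + 1 / 2) / (4 ^ j * (j.factorial : ℝ))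

lemma besselCoeff_zero (ν : ℕ) : besselCoeff ν 0 = 1 := by simp [besselCoeff]

/-- Passing from j to j+1 extends the Pochhammer product by one factor at each end, ν-j-1/2 and
ν+j+1/2, whose product is ν² - (j+1/2)². -/
lemma besselCoeff_succ (ν j : ℕ) :
    besselCoeff ν (j + 1) =
      ((ν : ℝ) ^ 2 - (j + 1 / 2) ^ 2) / (4 * (j + 1)) * besselCoeff ν j := by
  have h : (ascPochhammer ℝ (2 * (j + 1))).eval ((ν : ℝ) - (j + 1 : ℕ) + 1 / 2) =
      ((ν : ℝ) ^ 2 - (j + 1 / 2) ^ 2) *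
        (ascPochhammer ℝ (2 * j)).eval ((ν : ℝ) - j + 1 / 2) := by
    have e : 2 * (j + 1) = 2 * j + 1 + 1 := by ring
    rw [e, ascPochhammer_succ_eval, ascPochhammer_succ_left]
    simp only [Polynomial.eval_mul, Polynomial.eval_X, Polynomial.eval_comp, Polynomial.eval_add,
      Polynomial.eval_one]
    push_cast
    have e2 : (ν : ℝ) - (j + 1) + 1 / 2 + 1 = ν - j + 1 / 2 := by ring
    rw [e2]
    ring
  rw [besselCoeff, besselCoeff, h, Nat.factorial_succ, pow_succ]
  push_cast
  generalize (ascPochhammer ℝ (2 * j)).eval ((ν : ℝ) - j + 1 / 2) = P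
  have := Nat.cast_ne_zero (R := ℝ).2 j.factorial_ne_zero
  field_simp
  ring

/-- The even moments of the Gaussian weight `exp (-4 N x ^ 2)`. -/
noncomputable def gaussMoment (j : ℕ) (N : ℝ) : ℝ :=
  ∫ x : ℝ, x ^ (2 * j) * Real.exp (-(4 * N * x ^ 2))

lemma integrable_gaussMoment (j : ℕ) {N : ℝ} (hN : 0 < N) :
    Integrable fun x : ℝ => x ^ (2 * j) * Real.exp (-(4 * N * x ^ 2)) := by
  have h := integrable_rpow_mul_exp_neg_mul_sq (b := 4 * N) (by positivity)
    (s := ((2 * j : ℕ) : ℝ)) (by have : (0 : ℝ) ≤ ((2 * j : ℕ) : ℝ) := by positivity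
                                 linarith)
  simpa only [Real.rpow_natCast, neg_mul] using h

lemma gaussMoment_eq (j : ℕ) {N : ℝ} (hN : 0 < N) :
    gaussMoment j N = (4 * N) ^ (-((j : ℝ) + 1 / 2)) * Real.Gamma (j + 1 / 2) := by
  have h1 : gaussMoment j N = ∫ x : ℝ, (fun x => x ^ (2 * j) * Real.exp (-(4 * N * x ^ 2))) |x| := by
    refine integral_congr_ae (Filter.Eventually.of_forall fun x => ?_)
    simp only [pow_mul, sq_abs]
  have h2 := integral_rpow_mul_exp_neg_mul_rpow (p := 2) (q := ((2 * j : ℕ) : ℝ)) (b := 4 * N)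
    (by norm_num) (by have : (0 : ℝ) ≤ ((2 * j : ℕ) : ℝ) := by positivity
                      linarith) (by positivity)
  rw [h1, integral_comp_abs (f := fun x => x ^ (2 * j) * Real.exp (-(4 * N * x ^ 2)))]
  have h3 : ∫ x in Set.Ioi (0 : ℝ), x ^ (2 * j) * Real.exp (-(4 * N * x ^ 2)) =
      ∫ x in Set.Ioi (0 : ℝ), x ^ ((2 * j : ℕ) : ℝ) * Real.exp (-(4 * N) * x ^ (2 : ℝ)) := by
    refine setIntegral_congr_fun measurableSet_Ioi fun x _ => ?_
    simp only [Real.rpow_natCast, Real.rpow_two, neg_mul]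
  rw [h3, h2]
  have e : (((2 * j : ℕ) : ℝ) + 1) / 2 = j + 1 / 2 := by push_cast; ring
  have e' : -(((2 * j : ℕ) : ℝ) + 1) / 2 = -(j + 1 / 2) := by push_cast; ring
  rw [e, e']
  ring

lemma gaussMoment_mul (j : ℕ) {r N : ℝ} (hr : 0 < r) (hN : 0 < N) :
    gaussMoment j (r * N) = gaussMoment j r * (N⁻¹ ^ j / √N) := by
  rw [gaussMoment_eq j (by positivity), gaussMoment_eq j hr, ← mul_assoc,
    Real.mul_rpow (by positivity) hN.le]
  have : N ^ (-((j : ℝ) + 1 / 2)) = N⁻¹ ^ j / √N := by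
    rw [neg_add, Real.rpow_add hN, Real.rpow_neg hN.le, Real.rpow_natCast, Real.rpow_neg hN.le,
      ← Real.sqrt_eq_rpow, inv_pow]
    rfl
  rw [this]
  ring

/-- The ratio of consecutive `coshCoeff`, times the ratio (j+1/2)/4 of consecutive moments at N = 1,
is the ratio in `besselCoeff_succ`. The starting value comes from Γ(1/2) = √π. -/
lemma coshCoeff_mul_gaussMoment (ν j : ℕ) {N : ℝ} (hN : 0 < N) :
    coshCoeff ν j * gaussMoment j N = √Real.pi / 2 * (besselCoeff ν j * (N⁻¹ ^ j / √N)) := by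
  have h1 : coshCoeff ν j * gaussMoment j 1 = √Real.pi / 2 * besselCoeff ν j := by
    induction j with
    | zero =>
      rw [gaussMoment_eq 0 one_pos, besselCoeff_zero, coshCoeff]
      have : (4 : ℝ) ^ (-((1 : ℝ) / 2)) = 1 / 2 := by
        rw [show (4 : ℝ) = 2 ^ (2 : ℝ) by norm_num, ← Real.rpow_mul (by norm_num)]
        norm_num
      simp only [Nat.cast_zero, zero_add, mul_one, one_mul, this, Real.Gamma_one_half_eq]
      ring
    | succ j ih =>
      have h2 : gaussMoment (j + 1) 1 = (j + 1 / 2) / 4 * gaussMoment j 1 := by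
        rw [gaussMoment_eq _ one_pos, gaussMoment_eq _ one_pos]
        have e : ((j + 1 : ℕ) : ℝ) + 1 / 2 = (j + 1 / 2) + 1 := by push_cast; ring
        rw [e, Real.Gamma_add_one (by positivity), mul_one, neg_add, Real.rpow_add (by norm_num),
          Real.rpow_neg_one]
        ring
      rw [h2, coshCoeff, besselCoeff_succ]
      have : (4 * (ν : ℝ) ^ 2 - (2 * j + 1) ^ 2) / ((2 * j + 1) * (2 * j + 2)) * coshCoeff ν j *
          ((j + 1 / 2) / 4 * gaussMoment j 1) =
          ((ν : ℝ) ^ 2 - (j + 1 / 2) ^ 2) / (4 * (j + 1)) *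
            (coshCoeff ν j * gaussMoment j 1) := by
        field_simp
        ring
      rw [this, ih]
      ring
  have h2 := gaussMoment_mul j one_pos hN
  rw [one_mul] at h2
  rw [h2, ← mul_assoc, h1]
  ring

/-! ### Expansion of e^{2N} K_ν(2N) through x = sinh s -/

lemma integral_comp_sinh (g : ℝ → ℝ) :
    ∫ s, g (Real.sinh s) * Real.cosh s = ∫ x, g x := by
  have h := integral_image_eq_integral_abs_deriv_smul (s := Set.univ) (f := Real.sinh)
    (f' := Real.cosh) MeasurableSet.univ
    (fun x _ => (Real.hasDerivAt_sinh x).hasDerivWithinAt) Real.sinh_injective.injOn g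
  rw [Set.image_univ, Real.sinh_surjective.range_eq, setIntegral_univ, setIntegral_univ] at h
  rw [h]
  refine integral_congr_ae (Filter.Eventually.of_forall fun x => ?_)
  simp only [smul_eq_mul, abs_of_pos (Real.cosh_pos x)]
  ring

lemma integrable_comp_sinh {g : ℝ → ℝ} (hg : Integrable g) :
    Integrable fun s => g (Real.sinh s) * Real.cosh s := by
  have h := integrableOn_image_iff_integrableOn_abs_deriv_smul (s := Set.univ) (f := Real.sinh)
    (f' := Real.cosh) MeasurableSet.univ
    (fun x _ => (Real.hasDerivAt_sinh x).hasDerivWithinAt) Real.sinh_injective.injOn g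
  rw [Set.image_univ, Real.sinh_surjective.range_eq, integrableOn_univ, integrableOn_univ] at h
  refine (h.1 hg).congr (Filter.Eventually.of_forall fun x => ?_)
  simp only [smul_eq_mul, abs_of_pos (Real.cosh_pos x)]
  ring

lemma integrable_sinh_weight (j : ℕ) {N : ℝ} (hN : 0 < N) : Integrable fun s : ℝ =>
    Real.exp (-(4 * N * Real.sinh s ^ 2)) * (Real.sinh s ^ (2 * j) * Real.cosh s) :=
  (integrable_comp_sinh (integrable_gaussMoment j hN)).congr
    (Filter.Eventually.of_forall fun s => by ring)

lemma integral_sinh_weight (j : ℕ) (N : ℝ) : ∫ s : ℝ,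
    Real.exp (-(4 * N * Real.sinh s ^ 2)) * (Real.sinh s ^ (2 * j) * Real.cosh s) =
      gaussMoment j N := by
  rw [gaussMoment, ← integral_comp_sinh fun x => x ^ (2 * j) * Real.exp (-(4 * N * x ^ 2))]
  exact integral_congr_ae (Filter.Eventually.of_forall fun s => by ring)

lemma integrable_weight_cosh (ν : ℕ) {N : ℝ} (hN : 0 < N) : Integrable fun s : ℝ =>
    Real.exp (-(4 * N * Real.sinh s ^ 2)) * Real.cosh (2 * ν * s) := by
  -- With no terms subtracted, the remainder bound is a pointwise bound for cosh(2νs) itself.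
  obtain ⟨C, hC0, hC⟩ := exists_abs_cosh_sub_le ν 0
  refine (((integrable_sinh_weight 0 hN).add (integrable_sinh_weight ν hN)).const_mul C).mono'
    (by fun_prop) (Filter.Eventually.of_forall fun s => ?_)
  have := hC s
  simp only [Finset.range_zero, Finset.sum_empty, sub_zero, zero_add] at this
  rw [norm_mul, Real.norm_eq_abs, Real.norm_eq_abs, abs_of_pos (Real.exp_pos _)]
  calc _ ≤ Real.exp (-(4 * N * Real.sinh s ^ 2)) *
      (C * ((Real.sinh s ^ (2 * 0) + Real.sinh s ^ (2 * ν)) * Real.cosh s)) := by gcongr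
    _ = _ := by simp only [Pi.add_apply]; ring

lemma integrable_weight_exp (ν : ℕ) {N : ℝ} (hN : 0 < N) : Integrable fun s : ℝ =>
    Real.exp (-(4 * N * Real.sinh s ^ 2)) * Real.exp (2 * ν * s) := by
  refine ((integrable_weight_cosh ν hN).const_mul 2).mono' (by fun_prop)
    (Filter.Eventually.of_forall fun s => ?_)
  rw [norm_mul, Real.norm_eq_abs, Real.norm_eq_abs, Real.abs_exp, Real.abs_exp, Real.cosh_eq]
  have := Real.exp_pos (-(2 * ν * s))
  calc _ ≤ Real.exp (-(4 * N * Real.sinh s ^ 2)) *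
        (Real.exp (2 * ν * s) + Real.exp (-(2 * ν * s))) := by gcongr; linarith
    _ = _ := by ring

lemma integral_weight_exp (ν : ℕ) {N : ℝ} (hN : 0 < N) :
    ∫ s : ℝ, Real.exp (-(4 * N * Real.sinh s ^ 2)) * Real.exp (2 * ν * s) =
      ∫ s : ℝ, Real.exp (-(4 * N * Real.sinh s ^ 2)) * Real.cosh (2 * ν * s) := by
  have h1 := integrable_weight_exp ν hN
  have h2 := integral_neg_eq_self (fun s : ℝ =>
    Real.exp (-(4 * N * Real.sinh s ^ 2)) * Real.exp (2 * ν * s)) volume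
  have h3 : ∫ s : ℝ, Real.exp (-(4 * N * Real.sinh s ^ 2)) * Real.cosh (2 * ν * s) =
      ∫ s : ℝ, (1 / 2) * (Real.exp (-(4 * N * Real.sinh s ^ 2)) * Real.exp (2 * ν * s) +
        Real.exp (-(4 * N * Real.sinh (-s) ^ 2)) * Real.exp (2 * ν * (-s))) := by
    refine integral_congr_ae (Filter.Eventually.of_forall fun s => ?_)
    simp only [Real.cosh_eq, Real.sinh_neg, neg_sq, mul_neg]
    ring
  rw [h3, integral_const_mul, integral_add h1 h1.comp_neg, h2]
  ring

/-- Asymptotic expansion of the modified Bessel function of the second kind. -/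
lemma exists_abs_integral_weight_exp_sub_le (ν J : ℕ) : ∃ C : ℝ, 0 ≤ C ∧ ∀ N : ℝ, 1 ≤ N →
    |(∫ s : ℝ, Real.exp (-(4 * N * Real.sinh s ^ 2)) * Real.exp (2 * ν * s)) -
      ∑ j ∈ Finset.range J, √Real.pi / 2 * (besselCoeff ν j * (N⁻¹ ^ j / √N))| ≤
        C * (N⁻¹ ^ J / √N) := by
  obtain ⟨C, hC0, hC⟩ := exists_abs_cosh_sub_le ν J
  have hG : ∀ j, 0 ≤ gaussMoment j 1 := fun j =>
    integral_nonneg fun x => by rw [pow_mul]; positivity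
  refine ⟨C * (gaussMoment J 1 + gaussMoment (J + ν) 1),
    mul_nonneg hC0 (add_nonneg (hG _) (hG _)), fun N hN1 => ?_⟩
  have hN : 0 < N := by linarith
  have hsum : ∑ j ∈ Finset.range J, √Real.pi / 2 * (besselCoeff ν j * (N⁻¹ ^ j / √N)) =
      ∫ s : ℝ, ∑ j ∈ Finset.range J, coshCoeff ν j *
        (Real.exp (-(4 * N * Real.sinh s ^ 2)) * (Real.sinh s ^ (2 * j) * Real.cosh s)) := by
    rw [integral_finsetSum _ fun j _ => (integrable_sinh_weight j hN).const_mul _]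
    refine Finset.sum_congr rfl fun j _ => ?_
    rw [integral_const_mul, integral_sinh_weight, coshCoeff_mul_gaussMoment ν j hN]
  rw [integral_weight_exp ν hN, hsum, ← integral_sub (integrable_weight_cosh ν hN)
    (integrable_finsetSum _ fun j _ => (integrable_sinh_weight j hN).const_mul _)]
  have hb : Integrable fun s : ℝ => C *
      (Real.exp (-(4 * N * Real.sinh s ^ 2)) * (Real.sinh s ^ (2 * J) * Real.cosh s) +
        Real.exp (-(4 * N * Real.sinh s ^ 2)) * (Real.sinh s ^ (2 * (J + ν)) * Real.cosh s)) :=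
    ((integrable_sinh_weight J hN).add (integrable_sinh_weight (J + ν) hN)).const_mul C
  rw [← Real.norm_eq_abs]
  refine (norm_integral_le_of_norm_le hb (Filter.Eventually.of_forall fun s => ?_)).trans ?_
  · have h1 : Real.exp (-(4 * N * Real.sinh s ^ 2)) * Real.cosh (2 * ν * s) -
        ∑ j ∈ Finset.range J, coshCoeff ν j *
          (Real.exp (-(4 * N * Real.sinh s ^ 2)) * (Real.sinh s ^ (2 * j) * Real.cosh s)) =
        Real.exp (-(4 * N * Real.sinh s ^ 2)) * (Real.cosh (2 * ν * s) -
          ∑ j ∈ Finset.range J, coshCoeff ν j * (Real.sinh s ^ (2 * j) * Real.cosh s)) := by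
      rw [mul_sub, Finset.mul_sum]
      congr 1
      exact Finset.sum_congr rfl fun j _ => by ring
    rw [h1, norm_mul, Real.norm_eq_abs, Real.norm_eq_abs, Real.abs_exp]
    calc _ ≤ Real.exp (-(4 * N * Real.sinh s ^ 2)) * (C * ((Real.sinh s ^ (2 * J) +
          Real.sinh s ^ (2 * (J + ν))) * Real.cosh s)) := by gcongr; exact hC s
      _ = _ := by ring
  · rw [integral_const_mul, integral_add (integrable_sinh_weight J hN)
      (integrable_sinh_weight (J + ν) hN), integral_sinh_weight, integral_sinh_weight]
    have e1 := gaussMoment_mul J one_pos hN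
    have e2 := gaussMoment_mul (J + ν) one_pos hN
    rw [one_mul] at e1 e2
    -- The auxiliary power 2(J+ν) in the remainder costs nothing in the end: for N ≥ 1 its moment is
    -- of no larger order than the J-th one.
    have h3 : N⁻¹ ^ (J + ν) ≤ N⁻¹ ^ J :=
      pow_le_pow_of_le_one (by positivity) (inv_le_one_of_one_le₀ hN1) (by omega)
    rw [e1, e2, mul_assoc, add_mul]
    have := hG (J + ν)
    gcongr

/-! ### Expansion of π e^{-2N} I_ν(2N) through x = sin θ -/

lemma integral_weight_sin_eq (j : ℕ) (N : ℝ) :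
    ∫ θ in (-(Real.pi / 2))..(Real.pi / 2),
      Real.exp (-(4 * N * Real.sin θ ^ 2)) * (Real.sin θ ^ (2 * j) * Real.cos θ) =
        ∫ x in (-1 : ℝ)..1, x ^ (2 * j) * Real.exp (-(4 * N * x ^ 2)) := by
  have h := intervalIntegral.integral_comp_mul_deriv (a := -(Real.pi / 2)) (b := Real.pi / 2)
    (f := Real.sin) (f' := Real.cos) (g := fun x => x ^ (2 * j) * Real.exp (-(4 * N * x ^ 2)))
    (fun x _ => Real.hasDerivAt_sin x) (by fun_prop) (by fun_prop)
  rw [Real.sin_neg, Real.sin_pi_div_two] at h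
  rw [← h]
  exact intervalIntegral.integral_congr fun x _ => by simp only [Function.comp_apply]; ring

/-- Outside [-1, 1] one has x^{2j} ≤ x^{2J}, so the missing tail is at most a full moment of the
error's order; no exponential tail estimate is needed. -/
lemma abs_gaussMoment_sub_le {j J : ℕ} (hj : j ≤ J) {N : ℝ} (hN : 0 < N) :
    |(∫ x in (-1 : ℝ)..1, x ^ (2 * j) * Real.exp (-(4 * N * x ^ 2))) - gaussMoment j N| ≤
      gaussMoment J N := by
  have hi := integrable_gaussMoment j hN
  rw [intervalIntegral.integral_of_le (by norm_num), gaussMoment,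
    ← integral_add_compl (measurableSet_Ioc (a := (-1 : ℝ)) (b := 1)) hi, sub_add_cancel_left,
    abs_neg, ← Real.norm_eq_abs]
  refine (norm_integral_le_of_norm_le (integrable_gaussMoment J hN).integrableOn
    ((ae_restrict_iff' measurableSet_Ioc.compl).2 (Filter.Eventually.of_forall fun x hx => ?_))).trans
    (setIntegral_le_integral (integrable_gaussMoment J hN)
      (Filter.Eventually.of_forall fun x => ?_))
  · rw [norm_mul, Real.norm_eq_abs, Real.norm_eq_abs, Real.abs_exp, pow_mul, pow_mul,
      abs_of_nonneg (by positivity)]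
    have : 1 ≤ x ^ 2 := by
      rw [Set.mem_compl_iff, Set.mem_Ioc, not_and_or, not_lt, not_le] at hx
      rcases hx with hx | hx <;> nlinarith
    gcongr
  · simp only [Pi.zero_apply]
    rw [pow_mul]
    positivity

/-- Without a factor cos θ the substitution x = sin θ is unavailable. Instead 2|θ|/π ≤ |sin θ| ≤ |θ|
compares the integrand with a Gaussian in θ, whence the rescaling by (2/π)². -/
lemma integral_weight_sin_le (J : ℕ) {N : ℝ} (hN : 0 < N) :
    ∫ θ in (-(Real.pi / 2))..(Real.pi / 2),
      Real.exp (-(4 * N * Real.sin θ ^ 2)) * Real.sin θ ^ (2 * J) ≤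
        gaussMoment J ((2 / Real.pi) ^ 2 * N) := by
  have hp := Real.pi_pos
  have hi := integrable_gaussMoment J (N := (2 / Real.pi) ^ 2 * N) (by positivity)
  have hle : -(Real.pi / 2) ≤ Real.pi / 2 := by linarith
  calc _ ≤ ∫ θ in (-(Real.pi / 2))..(Real.pi / 2),
        θ ^ (2 * J) * Real.exp (-(4 * ((2 / Real.pi) ^ 2 * N) * θ ^ 2)) := by
        refine intervalIntegral.integral_mono_on hle
          (Continuous.intervalIntegrable (by fun_prop) _ _)
          (Continuous.intervalIntegrable (by fun_prop) _ _) fun θ hθ => ?_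
        have h1 : |θ| ≤ Real.pi / 2 := abs_le.2 hθ
        have h2 : (2 / Real.pi) ^ 2 * θ ^ 2 ≤ Real.sin θ ^ 2 := by
          rw [← mul_pow, ← sq_abs (Real.sin θ), ← sq_abs (2 / Real.pi * θ), abs_mul,
            abs_of_pos (by positivity : 0 < 2 / Real.pi)]
          gcongr
          exact Real.mul_abs_le_abs_sin h1
        have h3 : Real.sin θ ^ 2 ≤ θ ^ 2 := sq_le_sq.2 Real.abs_sin_le_abs
        rw [mul_comm, pow_mul, pow_mul]
        gcongr ?_ ^ J * Real.exp ?_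
        nlinarith
    _ ≤ _ := by
        rw [intervalIntegral.integral_of_le hle]
        refine setIntegral_le_integral hi (Filter.Eventually.of_forall fun x => ?_)
        simp only [Pi.zero_apply]
        rw [pow_mul]
        positivity

/-- Asymptotic expansion of the modified Bessel function of the first kind. -/
lemma exists_abs_integral_weight_cos_sub_le (ν J : ℕ) : ∃ C : ℝ, 0 ≤ C ∧ ∀ N : ℝ, 1 ≤ N →
    |(∫ θ in (-(Real.pi / 2))..(Real.pi / 2),
        Real.exp (-(4 * N * Real.sin θ ^ 2)) * Real.cos (2 * ν * θ)) -
      ∑ j ∈ Finset.range J, √Real.pi / 2 * ((-1) ^ j * besselCoeff ν j * (N⁻¹ ^ j / √N))| ≤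
        C * (N⁻¹ ^ J / √N) := by
  obtain ⟨C, hC0, hC⟩ := exists_abs_cos_sub_le ν J
  have hp := Real.pi_pos
  have hle : -(Real.pi / 2) ≤ Real.pi / 2 := by linarith
  have hG : ∀ j N, 0 ≤ gaussMoment j N := fun j N =>
    integral_nonneg fun x => by rw [pow_mul]; positivity
  refine ⟨C * gaussMoment J ((2 / Real.pi) ^ 2) + (∑ j ∈ Finset.range J, |coshCoeff ν j|) *
    gaussMoment J 1, add_nonneg (mul_nonneg hC0 (hG _ _)) (mul_nonneg (by positivity) (hG _ _)),
    fun N hN1 => ?_⟩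
  have hN : 0 < N := by linarith
  set E : ℝ → ℝ := fun θ => Real.exp (-(4 * N * Real.sin θ ^ 2)) with hE
  have hEc : Continuous E := by fun_prop
  set R : ℝ → ℝ := fun θ => Real.cos (2 * ν * θ) - ∑ j ∈ Finset.range J,
      coshCoeff ν j * ((-1) ^ j * (Real.sin θ ^ (2 * j) * Real.cos θ)) with hR
  have hRc : Continuous R := by fun_prop
  have hsplit : (∫ θ in (-(Real.pi / 2))..(Real.pi / 2), E θ * Real.cos (2 * ν * θ)) =
      (∫ θ in (-(Real.pi / 2))..(Real.pi / 2), E θ * R θ) +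
      ∑ j ∈ Finset.range J, coshCoeff ν j * (-1) ^ j *
        ∫ x in (-1 : ℝ)..1, x ^ (2 * j) * Real.exp (-(4 * N * x ^ 2)) := by
    simp_rw [← integral_weight_sin_eq, ← intervalIntegral.integral_const_mul]
    rw [← intervalIntegral.integral_finsetSum
      (fun j _ => Continuous.intervalIntegrable (by fun_prop) _ _),
      ← intervalIntegral.integral_add (Continuous.intervalIntegrable (by fun_prop) _ _)
        (Continuous.intervalIntegrable (by fun_prop) _ _)]
    refine intervalIntegral.integral_congr fun θ _ => ?_
    simp only [hE, hR, mul_sub, Finset.mul_sum]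
    rw [eq_comm, sub_add_eq_add_sub, sub_eq_iff_eq_add]
    congr 1
    exact Finset.sum_congr rfl fun j _ => by ring
  have hmain : ∑ j ∈ Finset.range J, √Real.pi / 2 * ((-1) ^ j * besselCoeff ν j *
      (N⁻¹ ^ j / √N)) = ∑ j ∈ Finset.range J, coshCoeff ν j * (-1) ^ j * gaussMoment j N :=
    Finset.sum_congr rfl fun j _ => by
      rw [mul_right_comm (coshCoeff ν j), coshCoeff_mul_gaussMoment ν j hN]; ring
  rw [hsplit, hmain, add_sub_assoc, ← Finset.sum_sub_distrib, add_mul]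
  have e1 := gaussMoment_mul J one_pos hN
  rw [one_mul] at e1
  refine (abs_add_le _ _).trans (add_le_add ?_ ?_)
  · rw [mul_assoc, ← gaussMoment_mul J (by positivity) hN]
    calc _ ≤ ∫ θ in (-(Real.pi / 2))..(Real.pi / 2), C * (E θ * Real.sin θ ^ (2 * J)) := by
          rw [← Real.norm_eq_abs]
          refine intervalIntegral.norm_integral_le_of_norm_le hle
            (Filter.Eventually.of_forall fun θ hθ => ?_)
            (Continuous.intervalIntegrable (by fun_prop) _ _)
          rw [norm_mul, Real.norm_eq_abs, Real.norm_eq_abs, hE, Real.abs_exp, mul_left_comm]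
          gcongr
          exact hC θ (abs_le.2 ⟨hθ.1.le, hθ.2⟩)
      _ ≤ _ := by
          rw [intervalIntegral.integral_const_mul]
          gcongr
          exact integral_weight_sin_le J hN
  · rw [mul_assoc, ← e1, Finset.sum_mul]
    refine (Finset.abs_sum_le_sum_abs _ _).trans (Finset.sum_le_sum fun j hj => ?_)
    rw [← mul_sub, abs_mul, abs_mul, abs_pow, abs_neg, abs_one, one_pow, mul_one]
    gcongr
    exact abs_gaussMoment_sub_le (Finset.mem_range.1 hj).le hN

/-! ### Analytic continuation and Taylor expansion of exp μ -/

/-- The entire function `(exp h - 1) / h`. -/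
noncomputable def expQuot (h : ℂ) : ℂ := dslope Complex.exp 0 h

/-- The analytic continuation of `μ` to the disk `‖h‖ < 2π`. -/
noncomputable def muC (h : ℂ) : ℂ := dslope expQuot 0 h / expQuot h - 1 / 2

lemma expQuot_zero : expQuot 0 = 1 := by simp [expQuot, dslope_same]

lemma expQuot_of_ne {h : ℂ} (hh : h ≠ 0) : expQuot h = (Complex.exp h - 1) / h := by
  rw [expQuot, dslope_of_ne _ hh, slope_def_field]
  simp

lemma exp_sub_one_ne_zero {h : ℂ} (hh : h ≠ 0) (h4 : ‖h‖ < 4) : Complex.exp h - 1 ≠ 0 := by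
  intro h0
  obtain ⟨n, hn⟩ := Complex.exp_eq_one_iff.1 (sub_eq_zero.1 h0)
  have hn0 : n ≠ 0 := by
    rintro rfl
    simp at hn
    exact hh hn
  have h1 : (1 : ℝ) ≤ |(n : ℝ)| := by exact_mod_cast Int.one_le_abs hn0
  have h2 : ‖h‖ = |(n : ℝ)| * (2 * Real.pi) := by
    rw [hn]
    simp [abs_of_pos Real.pi_pos]
  have := Real.pi_gt_three
  nlinarith

lemma expQuot_ne_zero {h : ℂ} (h4 : ‖h‖ < 4) : expQuot h ≠ 0 := by
  rcases eq_or_ne h 0 with rfl | hh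
  · simp [expQuot_zero]
  · rw [expQuot_of_ne hh]
    exact div_ne_zero (exp_sub_one_ne_zero hh h4) hh

lemma differentiable_expQuot : Differentiable ℂ expQuot := by
  rw [← differentiableOn_univ]
  exact (Complex.differentiableOn_dslope Filter.univ_mem).2
    Complex.differentiable_exp.differentiableOn

lemma differentiableOn_muC : DifferentiableOn ℂ muC (Metric.ball 0 4) := by
  refine DifferentiableOn.sub (DifferentiableOn.div ?_ differentiable_expQuot.differentiableOn
    fun h hh => expQuot_ne_zero (by simpa using hh)) (differentiableOn_const _)
  exact (Complex.differentiableOn_dslope (Metric.ball_mem_nhds _ (by norm_num))).2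
    differentiable_expQuot.differentiableOn

lemma muC_of_ne {h : ℂ} (hh : h ≠ 0) (h4 : ‖h‖ < 4) :
    muC h = h⁻¹ - (Complex.exp h - 1)⁻¹ - 1 / 2 := by
  rw [muC, dslope_of_ne _ hh, slope_def_field, expQuot_zero, expQuot_of_ne hh]
  have := exp_sub_one_ne_zero hh h4
  field_simp
  ring

/-- Away from 0 this is 1/(e^{-h}-1) = -1 - 1/(e^h-1); the value at 0 follows by continuity. Oddness
turns the factor exp(-μ(h)) in the integral for a into exp μ(-h). -/
lemma muC_neg {h : ℂ} (h4 : ‖h‖ < 4) : muC (-h) = -muC h := by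
  have hne : ∀ h : ℂ, h ≠ 0 → ‖h‖ < 4 → muC (-h) + muC h = 0 := by
    intro h hh h4
    rw [muC_of_ne hh h4, muC_of_ne (neg_ne_zero.2 hh) (by simpa using h4), Complex.exp_neg]
    have h1 := exp_sub_one_ne_zero hh h4
    have h2 := Complex.exp_ne_zero h
    have h5 : ((Complex.exp h)⁻¹ - 1)⁻¹ = -1 - (Complex.exp h - 1)⁻¹ := by
      refine inv_eq_of_mul_eq_one_right ?_
      field_simp
      ring
    rw [h5, inv_neg]
    ring
  rcases eq_or_ne h 0 with rfl | hh
  · have hc : ContinuousAt muC 0 :=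
      (differentiableOn_muC.differentiableAt (Metric.ball_mem_nhds _ (by norm_num))).continuousAt
    have hc' : ContinuousAt (fun h => muC (-h) + muC h) 0 :=
      (ContinuousAt.comp (g := muC) (f := fun h => -h) (by simpa using hc) continuousAt_neg).add hc
    have h1 := hc'.tendsto.mono_left (nhdsWithin_le_nhds (s := {0}ᶜ))
    have h2 : Filter.Tendsto (fun h => muC (-h) + muC h) (nhdsWithin 0 {0}ᶜ) (nhds 0) := by
      refine tendsto_const_nhds.congr' ?_
      filter_upwards [self_mem_nhdsWithin,
        nhdsWithin_le_nhds (Metric.ball_mem_nhds (0 : ℂ) (by norm_num : (0 : ℝ) < 4))] with h h5 h6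
      exact (hne h h5 (by simpa using h6)).symm
    exact eq_neg_of_add_eq_zero_left (tendsto_nhds_unique h1 h2)
  · exact eq_neg_of_add_eq_zero_left (hne h hh h4)

lemma muC_zero : muC 0 = 0 := by
  have := muC_neg (h := 0) (by simp)
  rw [neg_zero] at this
  exact self_eq_neg.1 this

lemma muC_ofReal {h : ℝ} (h4 : |h| < 4) : muC h = (μ h : ℂ) := by
  rcases eq_or_ne h 0 with rfl | hh
  · simp [muC_zero, μ]
  · rw [muC_of_ne (by exact_mod_cast hh) (by simpa using h4), μ, if_neg hh]
    push_cast
    rfl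

/-- The analytic continuation of `exp μ`. -/
noncomputable def expMu (h : ℂ) : ℂ := Complex.exp (muC h)

lemma differentiableOn_expMu : DifferentiableOn ℂ expMu (Metric.ball 0 4) :=
  differentiableOn_muC.cexp

lemma expMu_ofReal {h : ℝ} (h4 : |h| < 4) : expMu h = (Real.exp (μ h) : ℂ) := by
  rw [expMu, muC_ofReal h4, Complex.ofReal_exp]

/-- The Taylor coefficients of `exp μ` at `0`. -/
noncomputable def expMuCoeff (k : ℕ) : ℝ := maclaurinCoeff (fun h : ℝ => Real.exp (μ h)) k

/-- Needed because c_m is defined by real derivatives of exp μ, while the Taylor estimate comes from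
complex analyticity. -/
lemma ofReal_iteratedDeriv {f : ℝ → ℝ} {g : ℂ → ℂ} {x : ℝ} (hg : AnalyticAt ℂ g x)
    (hfg : ∀ᶠ y : ℝ in nhds x, g y = f y) (n : ℕ) :
    ((iteratedDeriv n f x : ℝ) : ℂ) = iteratedDeriv n g x := by
  induction n generalizing f g with
  | zero => simpa using hfg.self_of_nhds.symm
  | succ n ih =>
    rw [iteratedDeriv_succ', iteratedDeriv_succ']
    refine ih hg.deriv ?_
    have h1 : ∀ᶠ y : ℝ in nhds x, AnalyticAt ℂ g y :=
      Complex.continuous_ofReal.continuousAt.eventually hg.eventually_analyticAt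
    filter_upwards [h1, hfg.eventually_nhds] with y hy hy'
    have h2 := hy.differentiableAt.hasDerivAt.comp_ofReal
    have h3 : HasDerivAt f (deriv g y).re y := by
      refine hy.differentiableAt.hasDerivAt.real_of_complex.congr_of_eventuallyEq ?_
      filter_upwards [hy'] with t ht
      rw [ht, Complex.ofReal_re]
    have h4 : HasDerivAt (fun t : ℝ => g t) ((deriv g y).re : ℂ) y := by
      refine h3.ofReal_comp.congr_of_eventuallyEq ?_
      filter_upwards [hy'] with t ht
      exact ht
    rw [h3.deriv]
    exact h2.unique h4

lemma ofReal_expMuCoeff (k : ℕ) : (expMuCoeff k : ℂ) = maclaurinCoeff expMu k := by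
  have hA : AnalyticAt ℂ expMu ((0 : ℝ) : ℂ) := by
    rw [Complex.ofReal_zero]
    exact differentiableOn_expMu.analyticAt (Metric.ball_mem_nhds _ (by norm_num))
  have h := ofReal_iteratedDeriv (f := fun h : ℝ => Real.exp (μ h)) hA (by
    filter_upwards [Metric.ball_mem_nhds (0 : ℝ) (by norm_num : (0 : ℝ) < 4)] with y hy
    exact expMu_ofReal (by simpa using hy)) k
  rw [expMuCoeff, maclaurinCoeff, maclaurinCoeff]
  push_cast
  rw [h, Complex.ofReal_zero]

lemma exists_norm_expMu_sub_le (K : ℕ) : ∃ C : ℝ, 0 ≤ C ∧ ∀ h : ℂ, ‖h‖ ≤ 1 →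
    ‖expMu h - ∑ k ∈ Finset.range K, (expMuCoeff k : ℂ) * h ^ k‖ ≤ C * ‖h‖ ^ K := by
  have hd : DifferentiableOn ℂ expMu (Metric.closedBall 0 ((3 : NNReal) : ℝ)) :=
    differentiableOn_expMu.mono (Metric.closedBall_subset_ball (by norm_num))
  have hp := hd.hasFPowerSeriesOnBall (by norm_num)
  have hA : AnalyticAt ℂ expMu 0 :=
    differentiableOn_expMu.analyticAt (Metric.ball_mem_nhds _ (by norm_num))
  -- By uniqueness, the Cauchy power series on the disk of radius 3 is the Taylor series.
  rw [hp.hasFPowerSeriesAt.eq_formalMultilinearSeries hA.hasFPowerSeriesAt] at hp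
  obtain ⟨q, hq, C, hC, h⟩ := hp.uniform_geometric_approx' (r' := 2) (by norm_num)
  refine ⟨C * (q * 2⁻¹) ^ K, by have := hq.1; positivity, fun z hz => ?_⟩
  have h1 := h z (by simp; linarith) K
  rw [zero_add, FormalMultilinearSeries.partialSum] at h1
  simp only [FormalMultilinearSeries.ofScalars_apply_eq, smul_eq_mul] at h1
  simp only [ofReal_expMuCoeff, maclaurinCoeff]
  refine h1.trans_eq ?_
  rw [mul_assoc, ← mul_pow]
  push_cast
  ring

/-- The integral for b runs over all h > 0, so the Taylor bound must be global. For h ≥ 1 it is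
crude: μ ≤ 1, and each power h^k with k < K is at most h^K. -/
lemma exists_abs_exp_mu_sub_le (K : ℕ) : ∃ C : ℝ, 0 ≤ C ∧ ∀ h : ℝ, 0 < h →
    |Real.exp (μ h) - ∑ k ∈ Finset.range K, expMuCoeff k * h ^ k| ≤ C * h ^ K := by
  obtain ⟨C, hC0, hC⟩ := exists_norm_expMu_sub_le K
  set B := Real.exp 1 + ∑ k ∈ Finset.range K, |expMuCoeff k|
  have hB : 0 ≤ B := by positivity
  refine ⟨C + B, by positivity, fun h hh => ?_⟩
  rcases le_total h 1 with h1 | h1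
  · have h2 := hC h (by simpa [abs_of_pos hh] using h1)
    rw [expMu_ofReal (by rw [abs_of_pos hh]; linarith)] at h2
    have h3 : (Real.exp (μ h) : ℂ) - ∑ k ∈ Finset.range K, (expMuCoeff k : ℂ) * (h : ℂ) ^ k =
        ((Real.exp (μ h) - ∑ k ∈ Finset.range K, expMuCoeff k * h ^ k : ℝ) : ℂ) := by
      push_cast
      rfl
    rw [h3, Complex.norm_real, Complex.norm_real, Real.norm_eq_abs, Real.norm_eq_abs,
      abs_of_pos hh] at h2
    refine h2.trans ?_
    gcongr
    linarith
  · have hμ : μ h ≤ 1 := by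
      rw [μ, if_neg hh.ne']
      have e1 : h⁻¹ ≤ 1 := inv_le_one_of_one_le₀ h1
      have e2 : 0 ≤ (Real.exp h - 1)⁻¹ := inv_nonneg.2 (by have := Real.add_one_le_exp h; linarith)
      linarith
    calc _ ≤ |Real.exp (μ h)| + |∑ k ∈ Finset.range K, expMuCoeff k * h ^ k| := abs_sub _ _
      _ ≤ Real.exp 1 * h ^ K + ∑ k ∈ Finset.range K, |expMuCoeff k| * h ^ K := by
          gcongr
          · rw [Real.abs_exp]
            calc Real.exp (μ h) ≤ Real.exp 1 * 1 := by rw [mul_one]; gcongr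
              _ ≤ _ := by gcongr; exact one_le_pow₀ h1
          · refine (Finset.abs_sum_le_sum_abs _ _).trans (Finset.sum_le_sum fun k hk => ?_)
            rw [abs_mul, abs_pow, abs_of_pos hh]
            have := Finset.mem_range.1 hk
            gcongr ?_ * ?_
            exact pow_le_pow_right₀ h1 this.le
      _ = B * h ^ K := by rw [← Finset.sum_mul]; ring
      _ ≤ _ := by gcongr; linarith

lemma continuousOn_mu : ContinuousOn μ (Set.Ioi 0) := by
  have : ContinuousOn (fun h : ℝ => h⁻¹ - (Real.exp h - 1)⁻¹ - 1 / 2) (Set.Ioi 0) := by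
    refine ContinuousOn.sub (ContinuousOn.sub ?_ ?_) continuousOn_const
    · exact continuousOn_inv₀.mono fun x hx => (ne_of_gt hx : x ≠ 0)
    · exact ContinuousOn.inv₀ (by fun_prop) fun x hx => by
        have := Real.add_one_le_exp x
        have hx : 0 < x := hx
        linarith
  exact this.congr fun h hh => by rw [μ, if_neg (ne_of_gt hh)]

/-! ### Contour integral for a_n -/

lemma hasSum_circleIntegral_exp {v w : ℂ → ℂ} {R : ℝ} (hR : 0 ≤ R)
    (hv : ContinuousOn v (Metric.sphere 0 R)) (hw : ContinuousOn w (Metric.sphere 0 R)) :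
    HasSum (fun k : ℕ => (∮ z in C(0, R), v z * w z ^ k) / (k.factorial : ℂ))
      (∮ z in C(0, R), v z * Complex.exp (w z)) := by
  obtain ⟨V, hV⟩ := (isCompact_sphere (0 : ℂ) R).exists_bound_of_continuousOn hv
  obtain ⟨W, hW⟩ := (isCompact_sphere (0 : ℂ) R).exists_bound_of_continuousOn hw
  have hm : ∀ θ, circleMap 0 R θ ∈ Metric.sphere (0 : ℂ) R := fun θ => circleMap_mem_sphere 0 hR θ
  have hvc : Continuous fun θ => v (circleMap 0 R θ) :=
    hv.comp_continuous (continuous_circleMap 0 R) hm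
  have hwc : Continuous fun θ => w (circleMap 0 R θ) :=
    hw.comp_continuous (continuous_circleMap 0 R) hm
  have hV0 : 0 ≤ V := (norm_nonneg _).trans (hV _ (hm 0))
  have hW0 : 0 ≤ W := (norm_nonneg _).trans (hW _ (hm 0))
  have hsum : Summable fun k : ℕ => R * V * (W ^ k / (k.factorial : ℝ)) :=
    (Real.summable_pow_div_factorial W).mul_left _
  have h := intervalIntegral.hasSum_integral_of_dominated_convergence
    (μ := volume) (a := 0) (b := 2 * Real.pi)
    (F := fun (k : ℕ) θ => deriv (circleMap 0 R) θ *
      (v (circleMap 0 R θ) * w (circleMap 0 R θ) ^ k / (k.factorial : ℂ)))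
    (f := fun θ => deriv (circleMap 0 R) θ *
      (v (circleMap 0 R θ) * Complex.exp (w (circleMap 0 R θ))))
    (fun (k : ℕ) _ => R * V * (W ^ k / (k.factorial : ℝ))) ?_ ?_ ?_ ?_ ?_
  · refine h.congr_fun fun k => ?_
    simp only [circleIntegral, ← intervalIntegral.integral_div]
    refine intervalIntegral.integral_congr fun θ _ => ?_
    simp only [smul_eq_mul]
    ring
  · intro k
    simp only [deriv_circleMap]
    exact (((continuous_circleMap 0 R).mul continuous_const).mul
      ((hvc.mul (hwc.pow k)).div_const _)).aestronglyMeasurable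
  · intro k
    refine Filter.Eventually.of_forall fun θ _ => ?_
    simp only [deriv_circleMap, norm_mul, norm_div, norm_pow, norm_circleMap_zero, Complex.norm_I,
      Complex.norm_natCast, mul_one, abs_of_nonneg hR]
    rw [mul_div_assoc, ← mul_assoc]
    gcongr
    · exact hV _ (hm θ)
    · exact hW _ (hm θ)
  · exact Filter.Eventually.of_forall fun _ _ => hsum
  · exact intervalIntegrable_const
  · refine Filter.Eventually.of_forall fun θ _ => HasSum.mul_left _ ?_
    simp only [mul_div_assoc]
    refine HasSum.mul_left _ ?_
    rw [Complex.exp_eq_exp_ℂ]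
    exact NormedSpace.expSeries_div_hasSum_exp _

/-- Used to compare contours around z = 0 and around h = 0, that is z = 1, without deforming one
into the other: after expanding the exponential, both families of periods satisfy Pascal's rule with
the same boundary values. -/
lemma eq_of_pascal {P Q : ℕ → ℕ → ℂ} (hP0 : ∀ n, P n 0 = 0) (hQ0 : ∀ n, Q n 0 = 0)
    (hP : ∀ n k, P (n + 1) (k + 1) = P n (k + 1) + P n k)
    (hQ : ∀ n k, Q (n + 1) (k + 1) = Q n (k + 1) + Q n k)
    (h0 : ∀ k, P 0 k = Q 0 k) (n k : ℕ) : P n k = Q n k := by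
  induction n generalizing k with
  | zero => exact h0 k
  | succ n ih =>
    rcases k with _ | k
    · rw [hP0, hQ0]
    · rw [hP, hQ, ih, ih]

/-- `∮ z^{-n-2} (z/(1-z))^k dz` around `0`. -/
noncomputable def moebiusPeriod (n k : ℕ) : ℂ :=
  ∮ z in C(0, 1 / 2), (1 / z ^ (n + 2)) * (z / (1 - z)) ^ k

/-- `∮ e^{(n+1)h} (e^h-1)^{-k} dh` around `0`. -/
noncomputable def expPeriod (r : ℝ) (n k : ℕ) : ℂ :=
  ∮ h in C(0, r), Complex.exp ((n + 1) * h) * ((Complex.exp h - 1)⁻¹) ^ k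

lemma one_sub_ne_zero_of_mem_closedBall {z : ℂ} (hz : z ∈ Metric.closedBall (0 : ℂ) (1 / 2)) :
    1 - z ≠ 0 := by
  intro h
  rw [← sub_eq_zero.1 h] at hz
  norm_num at hz

lemma differentiableOn_div_one_sub :
    DifferentiableOn ℂ (fun z : ℂ => z / (1 - z)) (Metric.closedBall 0 (1 / 2)) :=
  DifferentiableOn.div differentiableOn_id (by fun_prop)
    fun _ hz => one_sub_ne_zero_of_mem_closedBall hz

lemma ne_zero_of_mem_sphere_zero {z : ℂ} {r : ℝ} (hr : 0 < r) (hz : z ∈ Metric.sphere (0 : ℂ) r) :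
    z ≠ 0 := by
  rintro rfl
  simp at hz
  exact hr.ne hz

lemma moebiusPeriod_eq (n k : ℕ) : moebiusPeriod n k =
    (2 * Real.pi * Complex.I / ((n + 1).factorial : ℂ)) *
      iteratedDeriv (n + 1) (fun z : ℂ => (z / (1 - z)) ^ k) 0 := by
  have := DifferentiableOn.circleIntegral_one_div_sub_center_pow_smul (by norm_num) (n + 1)
    (differentiableOn_div_one_sub.fun_pow k)
  simpa [moebiusPeriod] using this

lemma moebiusPeriod_zero_right (n : ℕ) : moebiusPeriod n 0 = 0 := by
  rw [moebiusPeriod_eq]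
  simp [iteratedDeriv_const]

lemma moebiusPeriod_zero_left (k : ℕ) :
    moebiusPeriod 0 k = 2 * Real.pi * Complex.I * (k * 0 ^ (k - 1)) := by
  have h1 : HasDerivAt (fun z : ℂ => z / (1 - z)) 1 0 := by
    refine ((hasDerivAt_id (0 : ℂ)).div ((hasDerivAt_id (0 : ℂ)).const_sub 1) (by simp)).congr_deriv
      ?_
    simp
  rw [moebiusPeriod_eq, zero_add, iteratedDeriv_one, (h1.fun_pow k).deriv]
  simp

/-- With w = z/(1-z) one has 1/z = 1 + 1/w, hence z⁻¹w^{k+1} = w^{k+1} + w^k. -/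
lemma moebiusPeriod_succ (n k : ℕ) :
    moebiusPeriod (n + 1) (k + 1) = moebiusPeriod n (k + 1) + moebiusPeriod n k := by
  have hne : ∀ z ∈ Metric.sphere (0 : ℂ) (1 / 2), z ≠ 0 ∧ 1 - z ≠ 0 := fun z hz =>
    ⟨ne_zero_of_mem_sphere_zero (by norm_num) hz,
      one_sub_ne_zero_of_mem_closedBall (Metric.sphere_subset_closedBall hz)⟩
  have hi : ∀ n k : ℕ, CircleIntegrable
      (fun z : ℂ => (1 / z ^ (n + 2)) * (z / (1 - z)) ^ k) 0 (1 / 2) := fun n k => by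
    refine ContinuousOn.circleIntegrable (by norm_num) (ContinuousOn.mul ?_ ?_)
    · exact continuousOn_const.div (by fun_prop) fun z hz => pow_ne_zero _ (hne z hz).1
    · exact (differentiableOn_div_one_sub.continuousOn.mono Metric.sphere_subset_closedBall).pow k
  rw [moebiusPeriod, moebiusPeriod, moebiusPeriod, ← circleIntegral.integral_add (hi _ _) (hi _ _)]
  refine circleIntegral.integral_congr (by norm_num) fun z hz => ?_
  obtain ⟨h1, h2⟩ := hne z hz
  simp only [pow_succ, div_pow]
  field_simp
  ring

lemma exp_sub_one_ne_zero_of_mem_sphere {r : ℝ} (hr : 0 < r) (hr1 : r ≤ 1) {h : ℂ}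
    (hh : h ∈ Metric.sphere (0 : ℂ) r) : Complex.exp h - 1 ≠ 0 :=
  exp_sub_one_ne_zero (ne_zero_of_mem_sphere_zero hr hh) (by
    have : ‖h‖ = r := by simpa using hh
    linarith)

lemma continuousOn_inv_exp_sub_one {r : ℝ} (hr : 0 < r) (hr1 : r ≤ 1) :
    ContinuousOn (fun h : ℂ => (Complex.exp h - 1)⁻¹) (Metric.sphere 0 r) :=
  ContinuousOn.inv₀ (by fun_prop) fun _ hh => exp_sub_one_ne_zero_of_mem_sphere hr hr1 hh

lemma circleIntegral_eq_zero_of_differentiableOn {f : ℂ → ℂ} {r : ℝ} (hr : 0 ≤ r)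
    (hf : DifferentiableOn ℂ f (Metric.closedBall 0 r)) : ∮ z in C(0, r), f z = 0 :=
  Complex.circleIntegral_eq_zero_of_differentiable_on_off_countable hr Set.countable_empty
    hf.continuousOn fun _ hz => hf.differentiableAt
      (Filter.mem_of_superset (Metric.isOpen_ball.mem_nhds hz.1) Metric.ball_subset_closedBall)

lemma expPeriod_zero_right {r : ℝ} (hr : 0 < r) (n : ℕ) : expPeriod r n 0 = 0 := by
  simp only [expPeriod, pow_zero, mul_one]
  exact circleIntegral_eq_zero_of_differentiableOn hr.le (by fun_prop)

/-- Here the extra factor is e^h = 1 + (e^h-1). -/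
lemma expPeriod_succ {r : ℝ} (hr : 0 < r) (hr1 : r ≤ 1) (n k : ℕ) :
    expPeriod r (n + 1) (k + 1) = expPeriod r n (k + 1) + expPeriod r n k := by
  have hi : ∀ n k : ℕ, CircleIntegrable
      (fun h : ℂ => Complex.exp ((n + 1) * h) * ((Complex.exp h - 1)⁻¹) ^ k) 0 r := fun n k =>
    ContinuousOn.circleIntegrable hr.le
      (ContinuousOn.mul (by fun_prop) ((continuousOn_inv_exp_sub_one hr hr1).pow k))
  rw [expPeriod, expPeriod, expPeriod, ← circleIntegral.integral_add (hi _ _) (hi _ _)]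
  refine circleIntegral.integral_congr hr.le fun h hh => ?_
  have h1 := exp_sub_one_ne_zero_of_mem_sphere hr hr1 hh
  have h2 : Complex.exp (((n + 1 : ℕ) + 1) * h) = Complex.exp ((n + 1) * h) * Complex.exp h := by
    rw [← Complex.exp_add]
    push_cast
    ring_nf
  simp only [h2, pow_succ, inv_pow]
  field_simp
  ring

/-- The right-hand side is 2πi for k = 1 and 0 otherwise. For k = 1 the integrand is 1/h plus a
function holomorphic on the disk; for k ≥ 2 it is the derivative of -(e^h-1)^{-(k-1)}/(k-1). -/
lemma expPeriod_zero_left {r : ℝ} (hr : 0 < r) (hr1 : r ≤ 1) (k : ℕ) :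
    expPeriod r 0 k = 2 * Real.pi * Complex.I * (k * 0 ^ (k - 1)) := by
  match k with
  | 0 => rw [expPeriod_zero_right hr]; simp
  | 1 =>
    have hd : DifferentiableOn ℂ (fun h => 1 / 2 - muC h) (Metric.closedBall 0 r) :=
      DifferentiableOn.sub (by fun_prop)
        (differentiableOn_muC.mono (Metric.closedBall_subset_ball (by linarith)))
    have h1 : expPeriod r 0 1 = ∮ h in C(0, r), ((h - 0)⁻¹ + (1 / 2 - muC h)) := by
      refine circleIntegral.integral_congr hr.le fun h hh => ?_
      have h1 := exp_sub_one_ne_zero_of_mem_sphere hr hr1 hh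
      have hn : ‖h‖ = r := by simpa using hh
      simp only [muC_of_ne (ne_zero_of_mem_sphere_zero hr hh) (by linarith), sub_zero, pow_one,
        Nat.cast_zero, zero_add, one_mul]
      have := ne_zero_of_mem_sphere_zero hr hh
      field_simp
      ring
    rw [h1, circleIntegral.integral_add, circleIntegral.integral_sub_center_inv 0 hr.ne',
      circleIntegral_eq_zero_of_differentiableOn hr.le hd]
    · simp
    · refine ContinuousOn.circleIntegrable hr.le (ContinuousOn.inv₀ (by fun_prop) fun h hh => ?_)
      simpa using ne_zero_of_mem_sphere_zero hr hh
    · exact (hd.continuousOn.mono Metric.sphere_subset_closedBall).circleIntegrable hr.le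
  | k + 2 =>
    have h0 : expPeriod r 0 (k + 2) = 0 := by
      refine circleIntegral.integral_eq_zero_of_hasDerivWithinAt
        (f := fun h => -((k + 1 : ℂ)⁻¹) * ((Complex.exp h - 1)⁻¹) ^ (k + 1)) hr.le fun h hh => ?_
      have h1 := exp_sub_one_ne_zero_of_mem_sphere hr hr1 hh
      refine HasDerivAt.hasDerivWithinAt (((((Complex.hasDerivAt_exp h).sub_const 1).fun_inv
        h1).fun_pow (k + 1)).const_mul (-((k + 1 : ℂ)⁻¹)) |>.congr_deriv ?_)
      have h2 : (k + 1 : ℂ) ≠ 0 := by exact_mod_cast Nat.succ_ne_zero k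
      simp only [Nat.add_sub_cancel, Nat.cast_add, Nat.cast_one, Nat.cast_zero, zero_add, one_mul]
      simp only [inv_pow]
      field_simp
      ring
    rw [h0]
    simp

/-- The residue of `f₀(z) z^{-n-1}` at `z = 1` determines its residue at `0`. -/
lemma a_eq_circleIntegral (n : ℕ) {r : ℝ} (hr : 0 < r) (hr1 : r ≤ 1) :
    a (n + 1) = (2 * Real.pi * Complex.I)⁻¹ *
      ∮ h in C(0, r), Complex.exp ((n + 1) * h) * Complex.exp (Complex.exp h - 1)⁻¹ := by
  have h1 := hasSum_circleIntegral_exp (v := fun h => Complex.exp ((n + 1) * h)) hr.le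
    (by fun_prop) (continuousOn_inv_exp_sub_one hr hr1)
  have h2 := hasSum_circleIntegral_exp (v := fun z : ℂ => 1 / z ^ (n + 2)) (R := 1 / 2)
    (by norm_num) (continuousOn_const.div (by fun_prop) fun z hz =>
      pow_ne_zero _ (ne_zero_of_mem_sphere_zero (by norm_num) hz))
    (differentiableOn_div_one_sub.continuousOn.mono Metric.sphere_subset_closedBall)
  have h3 : ∀ k, moebiusPeriod n k = expPeriod r n k :=
    eq_of_pascal moebiusPeriod_zero_right (expPeriod_zero_right hr) moebiusPeriod_succ
      (expPeriod_succ hr hr1)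
      (fun k => by rw [moebiusPeriod_zero_left, expPeriod_zero_left hr hr1]) n
  have h4 := h1.unique (h2.congr_fun fun k => by
    have := h3 k
    rw [moebiusPeriod, expPeriod] at this
    rw [this])
  have h5 := DifferentiableOn.circleIntegral_one_div_sub_center_pow_smul (by norm_num) (n + 1)
    (differentiableOn_div_one_sub.cexp)
  rw [h4]
  simp only [sub_zero, smul_eq_mul] at h5
  rw [h5, a, maclaurinCoeff]
  have := Complex.two_pi_I_ne_zero
  field_simp
  rfl

/-- The terms N²h + 1/h add up to 2N cos 2θ = 2N - 4N sin²θ, and what remains of 1/(e^h-1) is -1/2 -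
μ(h) = -1/2 + μ(-h). -/
lemma exp_mul_exp_inv_exp_sub_one {N : ℝ} (hN : 1 ≤ N) (θ : ℝ) {h : ℂ}
    (hh : h = (N : ℂ)⁻¹ * Complex.exp (2 * θ * Complex.I)) :
    Complex.exp ((N : ℂ) ^ 2 * h) * Complex.exp (Complex.exp h - 1)⁻¹ =
      Complex.exp (2 * N) * Complex.exp (-(1 / 2)) *
        ((Real.exp (-(4 * N * Real.sin θ ^ 2)) : ℂ) * expMu (-h)) := by
  have hN0 : (N : ℂ) ≠ 0 := by
    have : N ≠ 0 := by linarith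
    exact_mod_cast this
  have hnorm : ‖h‖ = N⁻¹ := by
    have : (2 * θ * Complex.I : ℂ) = ((2 * θ : ℝ) : ℂ) * Complex.I := by push_cast; ring
    rw [hh, norm_mul, this, Complex.norm_exp_ofReal_mul_I, norm_inv, Complex.norm_real,
      Real.norm_eq_abs, abs_of_pos (by linarith), mul_one]
  have h1 : ‖h‖ ≤ 1 := by rw [hnorm]; exact inv_le_one_of_one_le₀ hN
  have h0 : h ≠ 0 := by rw [hh]; exact mul_ne_zero (inv_ne_zero hN0) (Complex.exp_ne_zero _)
  have hmu := muC_of_ne h0 (by linarith)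
  have hinv : h⁻¹ = N * Complex.exp (-(2 * θ) * Complex.I) := by
    rw [hh, mul_inv, inv_inv, ← Complex.exp_neg]
    ring_nf
  have hN2 : (N : ℂ) ^ 2 * h = N * Complex.exp (2 * θ * Complex.I) := by
    rw [hh]; field_simp
  have hcos : Complex.exp (2 * θ * Complex.I) + Complex.exp (-(2 * θ) * Complex.I) =
      2 - 4 * Complex.sin θ ^ 2 := by
    rw [← Complex.two_cos, Complex.cos_two_mul, Complex.cos_sq']
    ring
  rw [expMu, muC_neg (by linarith), Complex.ofReal_exp, ← Complex.exp_add, ← Complex.exp_add,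
    ← Complex.exp_add, ← Complex.exp_add]
  congr 1
  push_cast
  rw [hN2]
  linear_combination hmu + (N : ℂ) * hcos + hinv

/-- Integral representation of `a` on the circle through the saddle point. -/
lemma a_eq_integral (n : ℕ) {N : ℝ} (hN : 1 ≤ N) (hn : N ^ 2 = n + 1) :
    a (n + 1) = Complex.exp (2 * N) * Complex.exp (-(1 / 2)) / (Real.pi * N) *
      ∫ θ in (-(Real.pi / 2))..(Real.pi / 2), (Real.exp (-(4 * N * Real.sin θ ^ 2)) : ℂ) *
        (Complex.exp (2 * θ * Complex.I) *
          expMu (-((N : ℂ)⁻¹ * Complex.exp (2 * θ * Complex.I)))) := by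
  have hN0 : (N : ℂ) ≠ 0 := by
    have : N ≠ 0 := by linarith
    exact_mod_cast this
  rw [a_eq_circleIntegral n (r := N⁻¹) (by positivity) (inv_le_one_of_one_le₀ hN)]
  set f : ℂ → ℂ := fun h => Complex.exp ((n + 1) * h) * Complex.exp (Complex.exp h - 1)⁻¹ with hf
  set g : ℝ → ℂ := fun φ => circleMap 0 N⁻¹ φ * Complex.I * f (circleMap 0 N⁻¹ φ) with hg
  have hper : Function.Periodic g (2 * Real.pi) := fun φ => by
    simp only [hg, periodic_circleMap 0 N⁻¹ φ]
  have h1 : ∮ h in C(0, N⁻¹), f h = ∫ φ in (0 : ℝ)..(2 * Real.pi), g φ := by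
    simp only [circleIntegral, deriv_circleMap, smul_eq_mul, hg]
  -- The substitution φ = 2θ, after shifting the period to [-π, π].
  have h2 : ∫ φ in (0 : ℝ)..(2 * Real.pi), g φ =
      2 * ∫ θ in (-(Real.pi / 2))..(Real.pi / 2), g (2 * θ) := by
    have e := hper.intervalIntegral_add_eq 0 (-Real.pi)
    rw [zero_add] at e
    rw [e, intervalIntegral.integral_comp_mul_left g two_ne_zero]
    simp only [Complex.real_smul]
    push_cast
    rw [← mul_assoc, mul_inv_cancel₀ two_ne_zero, one_mul]
    congr 1 <;> ring
  have h3 : ∀ θ : ℝ, g (2 * θ) = (N : ℂ)⁻¹ * Complex.I * (Complex.exp (2 * N) *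
      Complex.exp (-(1 / 2))) * ((Real.exp (-(4 * N * Real.sin θ ^ 2)) : ℂ) *
        (Complex.exp (2 * θ * Complex.I) *
          expMu (-((N : ℂ)⁻¹ * Complex.exp (2 * θ * Complex.I))))) := by
    intro θ
    have e : circleMap 0 N⁻¹ (2 * θ) = (N : ℂ)⁻¹ * Complex.exp (2 * θ * Complex.I) := by
      simp [circleMap]
    have hn' : (n + 1 : ℂ) = (N : ℂ) ^ 2 := by exact_mod_cast hn.symm
    simp only [hg, hf]
    rw [e, hn', exp_mul_exp_inv_exp_sub_one hN θ rfl]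
    ring
  rw [h1, h2]
  simp_rw [h3]
  rw [intervalIntegral.integral_const_mul]
  have hpi : (Real.pi : ℂ) ≠ 0 := by exact_mod_cast Real.pi_ne_zero
  have := Complex.I_ne_zero
  field_simp

/-! ### Real integral for b_n -/

lemma maclaurinCoeff_eq_of_hasSum {f : ℂ → ℂ} {u : ℕ → ℂ} (hu : ∀ n, ‖u n‖ ≤ 1)
    (h : ∀ z : ℂ, ‖z‖ < 1 → HasSum (fun n => u n * z ^ n) (f z)) (n : ℕ) :
    maclaurinCoeff f n = u n := by
  have hp : HasFPowerSeriesOnBall f (FormalMultilinearSeries.ofScalars ℂ u) 0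
      ((2⁻¹ : NNReal) : ENNReal) := by
    refine ⟨?_, by simp, fun {y} hy => ?_⟩
    · refine FormalMultilinearSeries.le_radius_of_summable _ ?_
      refine Summable.of_nonneg_of_le (fun n => by positivity) (fun n => ?_)
        (summable_geometric_of_lt_one (r := (2⁻¹ : ℝ)) (by norm_num) (by norm_num))
      rw [FormalMultilinearSeries.ofScalars_norm]
      push_cast
      exact mul_le_of_le_one_left (by positivity) (hu n)
    · rw [Metric.eball_coe, mem_ball_zero_iff] at hy
      push_cast at hy
      simpa [FormalMultilinearSeries.ofScalars_apply_eq, mul_comm] using h y (by linarith)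
  have h1 := hp.hasFPowerSeriesAt.eq_formalMultilinearSeries
    hp.hasFPowerSeriesAt.analyticAt.hasFPowerSeriesAt
  have h2 := congrArg (fun p => p n fun _ => (1 : ℂ)) h1
  simpa [FormalMultilinearSeries.ofScalars_apply_eq, maclaurinCoeff] using h2.symm

/-- The Maclaurin coefficients of `z ↦ (1 - z) / (1 + s (1 - z))`. -/
noncomputable def resolventCoeff (s : ℝ) : ℕ → ℝ
  | 0 => (1 + s)⁻¹
  | n + 1 => -(s ^ n / (1 + s) ^ (n + 2))

lemma abs_resolventCoeff_le {s : ℝ} (hs : 0 < s) (n : ℕ) : |resolventCoeff s n| ≤ 1 := by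
  rcases n with _ | n
  · rw [resolventCoeff, abs_of_pos (by positivity)]
    exact inv_le_one_of_one_le₀ (by linarith)
  · rw [resolventCoeff, abs_neg, abs_of_nonneg (by positivity), div_le_one (by positivity)]
    calc s ^ n ≤ (1 + s) ^ n := by gcongr; linarith
      _ ≤ _ := pow_le_pow_right₀ (by linarith) (by omega)

lemma one_sub_resolvent_ne_zero {s : ℝ} (hs : 0 < s) {z : ℂ} (hz : ‖z‖ < 1) :
    (1 : ℂ) + s - s * z ≠ 0 := by
  intro h
  have h1 : (1 + s : ℂ) = s * z := sub_eq_zero.1 h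
  have h2 : ‖(1 + s : ℂ)‖ = 1 + s := by
    rw [← Complex.ofReal_one, ← Complex.ofReal_add, Complex.norm_real, Real.norm_eq_abs,
      abs_of_pos (by linarith)]
  rw [h1, norm_mul, Complex.norm_real, Real.norm_eq_abs, abs_of_pos hs] at h2
  nlinarith

lemma hasSum_resolventCoeff {s : ℝ} (hs : 0 < s) {z : ℂ} (hz : ‖z‖ < 1) :
    HasSum (fun n => (resolventCoeff s n : ℂ) * z ^ n) ((1 - z) / (1 + s - s * z)) := by
  have hd := one_sub_resolvent_ne_zero hs hz
  have h1s : (1 + s : ℂ) ≠ 0 := by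
    have : 1 + s ≠ 0 := by linarith
    exact_mod_cast this
  have hlt : ‖(s / (1 + s) * z : ℂ)‖ < 1 := by
    have : ‖(s / (1 + s) : ℂ)‖ ≤ 1 := by
      rw [← Complex.ofReal_one, ← Complex.ofReal_add, ← Complex.ofReal_div, Complex.norm_real,
        Real.norm_eq_abs, abs_of_pos (by positivity), div_le_one (by positivity)]
      linarith
    rw [norm_mul]
    nlinarith [norm_nonneg z, norm_nonneg (s / (1 + s) : ℂ)]
  have hg := (hasSum_geometric_of_norm_lt_one hlt).mul_left (-(z / (1 + s) ^ 2))
  rw [← hasSum_nat_add_iff' 1]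
  have hval : (1 - z) / (1 + s - s * z) -
      ∑ i ∈ Finset.range 1, (resolventCoeff s i : ℂ) * z ^ i =
        -(z / (1 + s) ^ 2) * (1 - s / (1 + s) * z)⁻¹ := by
    have : (1 - s / (1 + s) * z : ℂ) = (1 + s - s * z) / (1 + s) := by field_simp
    rw [this, Finset.sum_range_one, resolventCoeff]
    push_cast
    generalize hD : (1 : ℂ) + s - s * z = D at hd
    field_simp
    linear_combination hD
  rw [hval]
  refine hg.congr_fun fun n => ?_
  rw [resolventCoeff]
  push_cast
  rw [mul_pow, div_pow]
  field_simp
  ring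

lemma integrableOn_exp_neg : IntegrableOn (fun s : ℝ => Real.exp (-s)) (Set.Ioi 0) :=
  integrableOn_exp_neg_Ioi 0

lemma integrableOn_resolventCoeff (n : ℕ) :
    IntegrableOn (fun s : ℝ => Real.exp (-s) * resolventCoeff s n) (Set.Ioi 0) := by
  refine Integrable.mono' integrableOn_exp_neg ?_
    ((ae_restrict_iff' measurableSet_Ioi).2 (Filter.Eventually.of_forall fun s hs => ?_))
  · refine Measurable.aestronglyMeasurable ?_
    rcases n with _ | n <;> simp only [resolventCoeff] <;> fun_prop
  · rw [norm_mul, Real.norm_eq_abs, Real.norm_eq_abs, Real.abs_exp]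
    exact mul_le_of_le_one_right (Real.exp_pos _).le (abs_resolventCoeff_le hs n)

lemma abs_integral_resolventCoeff_le (n : ℕ) :
    ∫ s in Set.Ioi (0 : ℝ), |Real.exp (-s) * resolventCoeff s n| ≤ 1 := by
  rw [← integral_exp_neg_Ioi_zero]
  refine setIntegral_mono_on (integrableOn_resolventCoeff n).norm integrableOn_exp_neg
    measurableSet_Ioi fun s hs => ?_
  rw [abs_mul, Real.abs_exp]
  exact mul_le_of_le_one_right (Real.exp_pos _).le (abs_resolventCoeff_le hs n)

lemma f₁_eq_integral {z : ℂ} (hz : ‖z‖ < 1) :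
    f₁ z = ∫ s in Set.Ioi (0 : ℝ), (Real.exp (-s) : ℂ) * ((1 - z) / (1 + s - s * z)) := by
  rw [f₁, E₁, ← integral_const_mul]
  refine setIntegral_congr_fun measurableSet_Ioi fun s hs => ?_
  have hd := one_sub_resolvent_ne_zero hs hz
  have h1 : 1 - z ≠ 0 := by
    intro h
    rw [← sub_eq_zero.1 h] at hz
    simp at hz
  have h2 : 1 / (1 - z) + s = (1 + s - s * z) / (1 - z) := by
    field_simp
    ring
  rw [← mul_div_assoc, ← Complex.exp_add, h2]
  have h3 : 1 / (1 - z) + -((1 + s - s * z) / (1 - z)) = -(s : ℂ) := by rw [← h2]; ring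
  rw [h3, Complex.ofReal_exp]
  push_cast
  field_simp

/-- The expansion of 1/(x+s) = (1-z)/(1+s(1-z)) in z may be integrated against e^{-s} termwise,
since the n-th term has L¹ norm at most |z|^n. -/
lemma b_eq_integral_resolventCoeff (n : ℕ) :
    b n = ((∫ s in Set.Ioi (0 : ℝ), Real.exp (-s) * resolventCoeff s n : ℝ) : ℂ) := by
  refine maclaurinCoeff_eq_of_hasSum
    (u := fun n => ((∫ s in Set.Ioi (0 : ℝ), Real.exp (-s) * resolventCoeff s n : ℝ) : ℂ))
    (fun n => ?_) (fun z hz => ?_) n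
  · rw [Complex.norm_real]
    exact (norm_integral_le_integral_norm _).trans (abs_integral_resolventCoeff_le n)
  · have h := hasSum_integral_of_summable_integral_norm (μ := volume.restrict (Set.Ioi (0 : ℝ)))
      (F := fun n s => ((Real.exp (-s) * resolventCoeff s n : ℝ) : ℂ) * z ^ n)
      (fun n => (integrableOn_resolventCoeff n).ofReal.mul_const _)
      (Summable.of_nonneg_of_le (fun n => integral_nonneg fun s => norm_nonneg _) (fun n => ?_)
        (summable_geometric_of_lt_one (norm_nonneg z) hz))
    · have hval : f₁ z = ∫ s in Set.Ioi (0 : ℝ),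
          ∑' n, ((Real.exp (-s) * resolventCoeff s n : ℝ) : ℂ) * z ^ n := by
        rw [f₁_eq_integral hz]
        refine setIntegral_congr_fun measurableSet_Ioi fun s hs => ?_
        refine ((hasSum_resolventCoeff hs hz).mul_left (Real.exp (-s) : ℂ)).tsum_eq.symm.trans ?_
        refine tsum_congr fun n => ?_
        push_cast
        ring
      rw [hval]
      refine h.congr_fun fun n => ?_
      rw [integral_mul_const, integral_complex_ofReal]
    · simp only [norm_mul, norm_pow]
      rw [integral_mul_const]
      refine mul_le_of_le_one_left (by positivity) ?_
      simpa only [Complex.norm_real, Real.norm_eq_abs, abs_mul] using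
        abs_integral_resolventCoeff_le n

/-- The substitution `t ↦ 1 / (exp (r e^{2t}) - 1)` used for `b`. -/
noncomputable def saddleMap (r t : ℝ) : ℝ := (Real.exp (r * Real.exp (2 * t)) - 1)⁻¹

lemma exp_sub_one_pos {r : ℝ} (hr : 0 < r) (t : ℝ) : 0 < Real.exp (r * Real.exp (2 * t)) - 1 := by
  have := Real.add_one_le_exp (r * Real.exp (2 * t))
  have : 0 < r * Real.exp (2 * t) := by positivity
  linarith

lemma saddleMap_injective {r : ℝ} (hr : 0 < r) : Function.Injective (saddleMap r) := by
  intro s t hst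
  have h1 := Real.exp_injective (sub_left_injective (inv_injective hst))
  have h2 := Real.exp_injective (mul_left_cancel₀ hr.ne' h1)
  linarith

lemma range_saddleMap {r : ℝ} (hr : 0 < r) : Set.range (saddleMap r) = Set.Ioi 0 := by
  ext y
  refine ⟨?_, fun hy => ?_⟩
  · rintro ⟨t, rfl⟩
    exact inv_pos.2 (exp_sub_one_pos hr t)
  · have hy : 0 < y := hy
    have h1 : 0 < Real.log (1 + y⁻¹) := Real.log_pos (by simpa using hy)
    refine ⟨Real.log (Real.log (1 + y⁻¹) / r) / 2, ?_⟩
    rw [saddleMap, mul_div_cancel₀ _ two_ne_zero, Real.exp_log (by positivity),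
      mul_div_cancel₀ _ hr.ne', Real.exp_log (by positivity)]
    simp

lemma hasDerivAt_saddleMap {r : ℝ} (hr : 0 < r) (t : ℝ) :
    HasDerivAt (saddleMap r) (-(Real.exp (r * Real.exp (2 * t)) * (2 * r * Real.exp (2 * t))) /
      (Real.exp (r * Real.exp (2 * t)) - 1) ^ 2) t := by
  have h1 : HasDerivAt (fun t : ℝ => r * Real.exp (2 * t))
      (r * (Real.exp (2 * t) * (2 * 1))) t :=
    (((hasDerivAt_id t).const_mul 2).exp).const_mul r
  refine ((h1.exp.sub_const 1).fun_inv (exp_sub_one_pos hr t).ne').congr_deriv ?_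
  ring

/-- Integral representation of `b` centred at the saddle point. -/
lemma b_eq_integral (n : ℕ) {N : ℝ} (hN : 0 < N) (hn : N ^ 2 = n + 1) :
    b (n + 1) = ((-(2 * Real.exp (1 / 2) * Real.exp (-(2 * N)) / N *
      ∫ s : ℝ, Real.exp (-(4 * N * Real.sinh s ^ 2)) *
        (Real.exp (2 * s) * Real.exp (μ (N⁻¹ * Real.exp (2 * s))))) : ℝ) : ℂ) := by
  rw [b_eq_integral_resolventCoeff]
  congr 1
  have hr : 0 < N⁻¹ := by positivity
  have h := integral_image_eq_integral_abs_deriv_smul (s := Set.univ) MeasurableSet.univ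
    (fun x _ => (hasDerivAt_saddleMap hr x).hasDerivWithinAt) (saddleMap_injective hr).injOn
    (fun s => Real.exp (-s) * resolventCoeff s (n + 1))
  rw [Set.image_univ, range_saddleMap hr, setIntegral_univ] at h
  rw [h, ← integral_const_mul, ← integral_neg]
  refine integral_congr_ae (Filter.Eventually.of_forall fun t => ?_)
  have hp := exp_sub_one_pos hr t
  have hc : N * Real.exp (2 * t) + N * Real.exp (-(2 * t)) =
      2 * N + 4 * N * Real.sinh t ^ 2 := by
    have e1 : Real.exp (2 * t) + Real.exp (-(2 * t)) = 2 * Real.cosh (2 * t) := by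
      rw [Real.cosh_eq]; ring
    rw [← mul_add, e1, Real.cosh_two_mul, Real.cosh_sq]
    ring
  simp only [resolventCoeff, saddleMap, smul_eq_mul]
  set h := N⁻¹ * Real.exp (2 * t) with hh
  have hh0 : 0 < h := by positivity
  have hinv : h⁻¹ = N * Real.exp (-(2 * t)) := by
    rw [hh, mul_inv, inv_inv, Real.exp_neg]
  have hN2 : N ^ 2 * h = N * Real.exp (2 * t) := by
    rw [hh]; field_simp
  have hμ : μ h = h⁻¹ - (Real.exp h - 1)⁻¹ - 1 / 2 := by rw [μ, if_neg hh0.ne']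
  -- The saddle identity with signs reversed: -N²h - 1/(e^h-1) = -(N²h + 1/h) + 1/2 + μ(h).
  have hexp : Real.exp (-(Real.exp h - 1)⁻¹) * Real.exp (-((n + 1 : ℝ) * h)) =
      Real.exp (1 / 2) * Real.exp (-(2 * N)) * Real.exp (-(4 * N * Real.sinh t ^ 2)) *
        Real.exp (μ h) := by
    rw [← Real.exp_add, ← Real.exp_add, ← Real.exp_add, ← Real.exp_add, ← hn]
    congr 1
    linear_combination -hμ - hN2 - hc - hinv
  have hpow : Real.exp (-((n + 1 : ℝ) * h)) = ((Real.exp h) ^ (n + 1))⁻¹ := by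
    rw [Real.exp_neg, ← Real.exp_nat_mul]
    push_cast
    rfl
  have habs : |-(Real.exp h * (2 * N⁻¹ * Real.exp (2 * t))) / (Real.exp h - 1) ^ 2| =
      Real.exp h * (2 * h) / (Real.exp h - 1) ^ 2 := by
    rw [neg_div, abs_neg, abs_of_pos (by positivity), hh, mul_assoc 2]
  rw [habs]
  have e1 : 1 + (Real.exp h - 1)⁻¹ = Real.exp h / (Real.exp h - 1) := by
    field_simp
    ring
  rw [e1]
  -- For s = 1/(e^h-1) one has s/(1+s) = e^{-h}. The Jacobian cancels the remaining powers of e^h-1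
  -- and leaves 2h e^{-(n+1)h} from the rational part.
  have e2 : Real.exp h * (2 * h) / (Real.exp h - 1) ^ 2 * (Real.exp (-(Real.exp h - 1)⁻¹) *
      -((Real.exp h - 1)⁻¹ ^ n / (Real.exp h / (Real.exp h - 1)) ^ (n + 2))) =
      -(2 * h * (Real.exp (-(Real.exp h - 1)⁻¹) * ((Real.exp h) ^ (n + 1))⁻¹)) := by
    have := Real.exp_pos h
    generalize Real.exp (-(Real.exp h - 1)⁻¹) = Y
    rw [inv_pow, div_pow]
    field_simp
    ring
  rw [e2, ← hpow, hexp, hh]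
  field_simp

/-! ### Combining the expansions of exp μ and of the Bessel functions -/

/-- The coefficients of the asymptotic series of `b`, which are those of `a` up to sign. -/
noncomputable def seriesCoeff (m : ℕ) : ℝ :=
  ∑ j ∈ Finset.range (m + 1), expMuCoeff (m - j) * besselCoeff (m - j + 1) j

lemma c_eq (m : ℕ) : c m = (-1) ^ m * seriesCoeff m := by
  rw [c, seriesCoeff]
  congr 1
  refine Finset.sum_congr rfl fun j hj => ?_
  have hj : j ≤ m := Nat.lt_succ_iff.1 (Finset.mem_range.1 hj)
  have e : ((m - j + 1 : ℕ) : ℝ) - j + 1 / 2 = (m : ℝ) - 2 * j + 3 / 2 := by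
    push_cast [Nat.cast_sub hj]
    ring
  rw [besselCoeff, e, expMuCoeff, mul_div_assoc]

/-- A truncated Cauchy product, grouped by m = k + j; the Bessel order k+1 varies with the Taylor
index k. -/
lemma sum_seriesCoeff (M : ℕ) (σ x : ℝ) :
    ∑ m ∈ Finset.range M, σ ^ m * seriesCoeff m * x ^ m =
      ∑ k ∈ Finset.range M, ∑ j ∈ Finset.range (M - k),
        expMuCoeff k * σ ^ k * x ^ k * (σ ^ j * besselCoeff (k + 1) j * x ^ j) := by
  rw [← Finset.sum_range_diag_flip]
  refine Finset.sum_congr rfl fun m _ => ?_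
  rw [← Finset.sum_range_reflect, seriesCoeff, Finset.mul_sum, Finset.sum_mul]
  refine Finset.sum_congr rfl fun j hj => ?_
  have hj : j ≤ m := Nat.lt_succ_iff.1 (Finset.mem_range.1 hj)
  have e1 : m + 1 - 1 - j = m - j := by omega
  have e2 : m - (m - j) = j := by omega
  rw [e1, e2]
  have h1 : ∀ y : ℝ, y ^ m = y ^ (m - j) * y ^ j := fun y => by
    rw [← pow_add, Nat.sub_add_cancel hj]
  rw [h1 σ, h1 x]
  ring

/-- Composing the Taylor expansion of `exp μ` with the expansions of the Bessel functions. -/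
lemma exists_norm_sub_sum_seriesCoeff_le {T : ℝ → ℂ} {A : ℕ → ℝ → ℝ} {σ : ℝ} {M : ℕ}
    (hA : ∀ ν J, ∃ C : ℝ, 0 ≤ C ∧ ∀ N : ℝ, 1 ≤ N → |A ν N -
      ∑ j ∈ Finset.range J, √Real.pi / 2 * (σ ^ j * besselCoeff ν j * (N⁻¹ ^ j / √N))| ≤
        C * (N⁻¹ ^ J / √N))
    (hT : ∃ C : ℝ, 0 ≤ C ∧ ∀ N : ℝ, 1 ≤ N → ‖T N -
      ((∑ k ∈ Finset.range M, expMuCoeff k * σ ^ k * N⁻¹ ^ k * A (k + 1) N : ℝ) : ℂ)‖ ≤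
        C * (N⁻¹ ^ M / √N)) :
    ∃ C : ℝ, 0 ≤ C ∧ ∀ N : ℝ, 1 ≤ N → ‖((2 / √Real.pi * √N : ℝ) : ℂ) * T N -
      ((∑ m ∈ Finset.range M, σ ^ m * seriesCoeff m * N⁻¹ ^ m : ℝ) : ℂ)‖ ≤ C * N⁻¹ ^ M := by
  obtain ⟨C, hC0, hC⟩ := hT
  choose D hD0 hD using hA
  -- The k-th Taylor term already carries N^{-k}, so its Bessel integral is expanded only to order
  -- M-k.
  set B := ∑ k ∈ Finset.range M, |expMuCoeff k * σ ^ k| * D (k + 1) (M - k)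
  have hB : 0 ≤ B := Finset.sum_nonneg fun k _ => mul_nonneg (abs_nonneg _) (hD0 _ _)
  refine ⟨2 / √Real.pi * (C + B), by positivity, fun N hN => ?_⟩
  have hNpos : 0 < N := by linarith
  have hs : 0 < √N := Real.sqrt_pos.2 hNpos
  have hpi : 0 < √Real.pi := Real.sqrt_pos.2 Real.pi_pos
  set S := ∑ m ∈ Finset.range M, σ ^ m * seriesCoeff m * N⁻¹ ^ m with hS
  have hS' : S = 2 / √Real.pi * √N * ∑ k ∈ Finset.range M, expMuCoeff k * σ ^ k * N⁻¹ ^ k *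
      ∑ j ∈ Finset.range (M - k),
        √Real.pi / 2 * (σ ^ j * besselCoeff (k + 1) j * (N⁻¹ ^ j / √N)) := by
    rw [hS, sum_seriesCoeff, Finset.mul_sum]
    refine Finset.sum_congr rfl fun k _ => ?_
    rw [Finset.mul_sum, Finset.mul_sum]
    refine Finset.sum_congr rfl fun j _ => ?_
    field_simp
  set P := ∑ k ∈ Finset.range M, expMuCoeff k * σ ^ k * N⁻¹ ^ k *
      ∑ j ∈ Finset.range (M - k),
        √Real.pi / 2 * (σ ^ j * besselCoeff (k + 1) j * (N⁻¹ ^ j / √N)) with hP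
  set Q := ∑ k ∈ Finset.range M, expMuCoeff k * σ ^ k * N⁻¹ ^ k * A (k + 1) N with hQ
  have h1 : |Q - P| ≤ B * (N⁻¹ ^ M / √N) := by
    rw [hQ, hP, ← Finset.sum_sub_distrib, Finset.sum_mul]
    refine (Finset.abs_sum_le_sum_abs _ _).trans (Finset.sum_le_sum fun k hk => ?_)
    rw [← mul_sub, abs_mul, abs_mul _ (N⁻¹ ^ k), abs_of_pos (by positivity : 0 < N⁻¹ ^ k)]
    have h2 := hD (k + 1) (M - k) N hN
    have h3 : N⁻¹ ^ M = N⁻¹ ^ k * N⁻¹ ^ (M - k) := by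
      rw [← pow_add, Nat.add_sub_cancel' (Finset.mem_range.1 hk).le]
    calc _ ≤ |expMuCoeff k * σ ^ k| * N⁻¹ ^ k * (D (k + 1) (M - k) * (N⁻¹ ^ (M - k) / √N)) := by
          gcongr
      _ = _ := by rw [h3]; ring
  have h2 : ((2 / √Real.pi * √N : ℝ) : ℂ) * T N - (S : ℂ) =
      ((2 / √Real.pi * √N : ℝ) : ℂ) * ((T N - (Q : ℂ)) + ((Q - P : ℝ) : ℂ)) := by
    rw [hS']
    push_cast
    ring
  rw [h2, norm_mul, Complex.norm_real, Real.norm_eq_abs, abs_of_pos (by positivity)]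
  calc _ ≤ 2 / √Real.pi * √N * (C * (N⁻¹ ^ M / √N) + B * (N⁻¹ ^ M / √N)) := by
        gcongr
        refine (norm_add_le _ _).trans (add_le_add (hC N hN) ?_)
        rwa [Complex.norm_real, Real.norm_eq_abs]
    _ = _ := by field_simp

/-- The saddle point integral of `a`. -/
noncomputable def circleSaddle (N : ℝ) : ℂ :=
  ∫ θ in (-(Real.pi / 2))..(Real.pi / 2), (Real.exp (-(4 * N * Real.sin θ ^ 2)) : ℂ) *
    (Complex.exp (2 * θ * Complex.I) * expMu (-((N : ℂ)⁻¹ * Complex.exp (2 * θ * Complex.I))))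

/-- The saddle point integral of `b`. -/
noncomputable def lineSaddle (N : ℝ) : ℝ :=
  ∫ s : ℝ, Real.exp (-(4 * N * Real.sinh s ^ 2)) *
    (Real.exp (2 * s) * Real.exp (μ (N⁻¹ * Real.exp (2 * s))))

/-- The weight is even in θ, so averaging over θ and -θ leaves only the cosine. -/
lemma integral_weight_cexp (ν : ℕ) (N : ℝ) :
    ∫ θ in (-(Real.pi / 2))..(Real.pi / 2), (Real.exp (-(4 * N * Real.sin θ ^ 2)) : ℂ) *
      Complex.exp (2 * θ * Complex.I) ^ ν =
    ((∫ θ in (-(Real.pi / 2))..(Real.pi / 2),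
        Real.exp (-(4 * N * Real.sin θ ^ 2)) * Real.cos (2 * ν * θ) : ℝ) : ℂ) := by
  set f : ℝ → ℂ := fun θ => (Real.exp (-(4 * N * Real.sin θ ^ 2)) : ℂ) *
      Complex.exp (2 * θ * Complex.I) ^ ν with hf
  have hc : Continuous f := by fun_prop
  have h1 : ∫ θ in (-(Real.pi / 2))..(Real.pi / 2), f (-θ) =
      ∫ θ in (-(Real.pi / 2))..(Real.pi / 2), f θ := by
    rw [intervalIntegral.integral_comp_neg, neg_neg]
  have h2 : ∫ θ in (-(Real.pi / 2))..(Real.pi / 2), (f θ + f (-θ)) =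
      2 * ∫ θ in (-(Real.pi / 2))..(Real.pi / 2), f θ := by
    have hc' : Continuous fun θ => f (-θ) := hc.comp continuous_neg
    rw [intervalIntegral.integral_add (hc.intervalIntegrable _ _) (hc'.intervalIntegrable _ _), h1]
    ring
  have h3 : ∀ θ : ℝ, f θ + f (-θ) =
      2 * ((Real.exp (-(4 * N * Real.sin θ ^ 2)) * Real.cos (2 * ν * θ) : ℝ) : ℂ) := by
    intro θ
    simp only [hf, ← Complex.exp_nat_mul, Real.sin_neg, neg_sq]
    push_cast
    have e := Complex.two_cos (2 * ν * θ : ℂ)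
    have e1 : (ν : ℂ) * (2 * θ * Complex.I) = 2 * ν * θ * Complex.I := by ring
    have e2 : (ν : ℂ) * (2 * -θ * Complex.I) = -(2 * ν * θ) * Complex.I := by ring
    rw [e1, e2]
    linear_combination -(Complex.exp (-(4 * N * Complex.sin θ ^ 2))) * e
  simp_rw [h3] at h2
  rw [intervalIntegral.integral_const_mul, intervalIntegral.integral_ofReal] at h2
  exact (mul_left_cancel₀ two_ne_zero h2).symm

/-- On the circle |h| = 1/N, so the Taylor remainder is uniformly O(N^{-M}) and only the total mass
O(N^{-1/2}) of the weight is needed. -/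
lemma exists_norm_circleSaddle_sub_le (M : ℕ) : ∃ C : ℝ, 0 ≤ C ∧ ∀ N : ℝ, 1 ≤ N →
    ‖circleSaddle N - ((∑ k ∈ Finset.range M, expMuCoeff k * (-1) ^ k * N⁻¹ ^ k *
      ∫ θ in (-(Real.pi / 2))..(Real.pi / 2),
        Real.exp (-(4 * N * Real.sin θ ^ 2)) * Real.cos (2 * (k + 1 : ℕ) * θ) : ℝ) : ℂ)‖ ≤
      C * (N⁻¹ ^ M / √N) := by
  obtain ⟨C, hC0, hC⟩ := exists_norm_expMu_sub_le M
  have hG : 0 ≤ gaussMoment 0 ((2 / Real.pi) ^ 2) := integral_nonneg fun x => by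
    simp only [mul_zero, pow_zero, one_mul, Pi.zero_apply]; positivity
  refine ⟨C * gaussMoment 0 ((2 / Real.pi) ^ 2), mul_nonneg hC0 hG, fun N hN => ?_⟩
  have hNpos : 0 < N := by linarith
  have hp := Real.pi_pos
  set E : ℝ → ℝ := fun θ => Real.exp (-(4 * N * Real.sin θ ^ 2)) with hE
  set w : ℝ → ℂ := fun θ => Complex.exp (2 * θ * Complex.I) with hw
  have hwn : ∀ θ, ‖w θ‖ = 1 := fun θ => by
    have : (2 * θ * Complex.I : ℂ) = ((2 * θ : ℝ) : ℂ) * Complex.I := by push_cast; ring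
    rw [hw]
    simp only
    rw [this, Complex.norm_exp_ofReal_mul_I]
  have hhn : ∀ θ, ‖-((N : ℂ)⁻¹ * w θ)‖ = N⁻¹ := fun θ => by
    rw [norm_neg, norm_mul, hwn, mul_one, norm_inv, Complex.norm_real, Real.norm_eq_abs,
      abs_of_pos hNpos]
  have hle1 : N⁻¹ ≤ 1 := inv_le_one_of_one_le₀ hN
  have hwc : Continuous w := by fun_prop
  have hEc : Continuous fun θ => (E θ : ℂ) := by fun_prop
  have hFc : Continuous fun θ => expMu (-((N : ℂ)⁻¹ * w θ)) :=
    differentiableOn_expMu.continuousOn.comp_continuous (by fun_prop) fun θ => by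
      rw [mem_ball_zero_iff, hhn]; linarith
  have hsum : ((∑ k ∈ Finset.range M, expMuCoeff k * (-1) ^ k * N⁻¹ ^ k *
      ∫ θ in (-(Real.pi / 2))..(Real.pi / 2), E θ * Real.cos (2 * (k + 1 : ℕ) * θ) : ℝ) : ℂ) =
      ∫ θ in (-(Real.pi / 2))..(Real.pi / 2), ∑ k ∈ Finset.range M,
        ((expMuCoeff k * (-1) ^ k * N⁻¹ ^ k : ℝ) : ℂ) * ((E θ : ℂ) * w θ ^ (k + 1)) := by
    rw [intervalIntegral.integral_finsetSum
      fun k _ => Continuous.intervalIntegrable (by fun_prop) _ _, Complex.ofReal_sum]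
    refine Finset.sum_congr rfl fun k _ => ?_
    rw [intervalIntegral.integral_const_mul, Complex.ofReal_mul, integral_weight_cexp (k + 1) N]
  have hEF : Continuous fun θ => (E θ : ℂ) * (w θ * expMu (-((N : ℂ)⁻¹ * w θ))) :=
    hEc.mul (hwc.mul hFc)
  rw [hsum, circleSaddle, ← intervalIntegral.integral_sub (hEF.intervalIntegrable _ _)
    (Continuous.intervalIntegrable (by fun_prop) _ _)]
  have hbound : ∀ θ, ‖(E θ : ℂ) * (w θ * expMu (-((N : ℂ)⁻¹ * w θ))) -
      ∑ k ∈ Finset.range M, ((expMuCoeff k * (-1) ^ k * N⁻¹ ^ k : ℝ) : ℂ) *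
        ((E θ : ℂ) * w θ ^ (k + 1))‖ ≤ C * N⁻¹ ^ M * (E θ * Real.sin θ ^ (2 * 0)) := by
    intro θ
    have e : (E θ : ℂ) * (w θ * expMu (-((N : ℂ)⁻¹ * w θ))) -
      ∑ k ∈ Finset.range M, ((expMuCoeff k * (-1) ^ k * N⁻¹ ^ k : ℝ) : ℂ) *
        ((E θ : ℂ) * w θ ^ (k + 1)) = (E θ : ℂ) * (w θ * (expMu (-((N : ℂ)⁻¹ * w θ)) -
          ∑ k ∈ Finset.range M, (expMuCoeff k : ℂ) * (-((N : ℂ)⁻¹ * w θ)) ^ k)) := by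
      rw [mul_sub, mul_sub, Finset.mul_sum, Finset.mul_sum]
      congr 1
      refine Finset.sum_congr rfl fun k _ => ?_
      rw [neg_pow (_ * w θ), mul_pow]
      push_cast
      ring
    have h1 := hC (-((N : ℂ)⁻¹ * w θ)) (by rw [hhn]; exact hle1)
    rw [hhn] at h1
    rw [e, norm_mul, norm_mul, hwn, one_mul, Complex.norm_real, Real.norm_eq_abs, hE,
      Real.abs_exp, mul_zero, pow_zero, mul_one, mul_comm]
    gcongr
  refine (intervalIntegral.norm_integral_le_of_norm_le (by linarith)
    (Filter.Eventually.of_forall fun θ _ => hbound θ)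
    (Continuous.intervalIntegrable (by fun_prop) _ _)).trans ?_
  rw [intervalIntegral.integral_const_mul]
  have h2 := integral_weight_sin_le 0 hNpos
  rw [gaussMoment_mul 0 (by positivity) hNpos, pow_zero] at h2
  calc _ ≤ C * N⁻¹ ^ M * (gaussMoment 0 ((2 / Real.pi) ^ 2) * (1 / √N)) := by gcongr
    _ = _ := by ring

/-- Here h = N⁻¹e^{2s} is unbounded, so the global remainder C h^M is integrated against the weight;
this is a Bessel integral of order M+1, for which the bound O(N^{-1/2}) suffices. -/
lemma exists_norm_lineSaddle_sub_le (M : ℕ) : ∃ C : ℝ, 0 ≤ C ∧ ∀ N : ℝ, 1 ≤ N →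
    ‖(lineSaddle N : ℂ) - ((∑ k ∈ Finset.range M, expMuCoeff k * 1 ^ k * N⁻¹ ^ k *
      ∫ s : ℝ, Real.exp (-(4 * N * Real.sinh s ^ 2)) * Real.exp (2 * (k + 1 : ℕ) * s) : ℝ) : ℂ)‖ ≤
      C * (N⁻¹ ^ M / √N) := by
  obtain ⟨C, hC0, hC⟩ := exists_abs_exp_mu_sub_le M
  -- The case K = 0 states that exp μ is bounded on h > 0, which gives integrability.
  obtain ⟨C₀, hC₀0, hC₀⟩ := exists_abs_exp_mu_sub_le 0
  obtain ⟨D, hD0, hD⟩ := exists_abs_integral_weight_exp_sub_le (M + 1) 0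
  refine ⟨C * D, mul_nonneg hC0 hD0, fun N hN => ?_⟩
  have hNpos : 0 < N := by linarith
  rw [← Complex.ofReal_sub, Complex.norm_real]
  set E : ℝ → ℝ := fun s => Real.exp (-(4 * N * Real.sinh s ^ 2)) with hE
  have hi : ∀ k : ℕ, Integrable fun s => E s * Real.exp (2 * (k + 1 : ℕ) * s) := fun k =>
    integrable_weight_exp (k + 1) hNpos
  have hpos : ∀ s : ℝ, 0 < N⁻¹ * Real.exp (2 * s) := fun s => by positivity
  have hexp : ∀ (k : ℕ) (s : ℝ), Real.exp (2 * (k + 1 : ℕ) * s) =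
      Real.exp (2 * s) * Real.exp (2 * s) ^ k := fun k s => by
    rw [← pow_succ', ← Real.exp_nat_mul]
    ring_nf
  have hiF : Integrable fun s => E s * (Real.exp (2 * s) *
      Real.exp (μ (N⁻¹ * Real.exp (2 * s)))) := by
    refine ((hi 0).const_mul C₀).mono' ?_ (Filter.Eventually.of_forall fun s => ?_)
    · have hμc : Continuous fun s : ℝ => μ (N⁻¹ * Real.exp (2 * s)) :=
        continuousOn_mu.comp_continuous (by fun_prop) hpos
      exact Continuous.aestronglyMeasurable (by fun_prop)
    · have h1 := hC₀ _ (hpos s)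
      simp only [Finset.range_zero, Finset.sum_empty, sub_zero, pow_zero, mul_one] at h1
      rw [Real.abs_exp] at h1
      rw [hexp, pow_zero, mul_one, norm_mul, norm_mul, Real.norm_eq_abs, Real.norm_eq_abs,
        Real.norm_eq_abs, hE, Real.abs_exp, Real.abs_exp, Real.abs_exp]
      calc _ ≤ Real.exp (-(4 * N * Real.sinh s ^ 2)) * (Real.exp (2 * s) * C₀) := by gcongr
        _ = _ := by ring
  have hsum : (∑ k ∈ Finset.range M, expMuCoeff k * 1 ^ k * N⁻¹ ^ k *
      ∫ s : ℝ, E s * Real.exp (2 * (k + 1 : ℕ) * s)) =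
      ∫ s : ℝ, ∑ k ∈ Finset.range M, expMuCoeff k * 1 ^ k * N⁻¹ ^ k *
        (E s * Real.exp (2 * (k + 1 : ℕ) * s)) := by
    rw [integral_finsetSum _ fun k _ => (hi k).const_mul _]
    exact Finset.sum_congr rfl fun k _ => (integral_const_mul _ _).symm
  rw [hsum, lineSaddle, ← integral_sub hiF
    (integrable_finsetSum _ fun k _ => (hi k).const_mul _)]
  refine (norm_integral_le_of_norm_le ((hi M).const_mul (C * N⁻¹ ^ M))
    (Filter.Eventually.of_forall fun s => ?_)).trans ?_
  · have e : E s * (Real.exp (2 * s) * Real.exp (μ (N⁻¹ * Real.exp (2 * s)))) -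
        ∑ k ∈ Finset.range M, expMuCoeff k * 1 ^ k * N⁻¹ ^ k *
          (E s * Real.exp (2 * (k + 1 : ℕ) * s)) =
        E s * (Real.exp (2 * s) * (Real.exp (μ (N⁻¹ * Real.exp (2 * s))) -
          ∑ k ∈ Finset.range M, expMuCoeff k * (N⁻¹ * Real.exp (2 * s)) ^ k)) := by
      rw [mul_sub, mul_sub, Finset.mul_sum, Finset.mul_sum]
      congr 1
      refine Finset.sum_congr rfl fun k _ => ?_
      rw [hexp, mul_pow]
      ring
    have h1 := hC _ (hpos s)
    rw [e, hexp, norm_mul, norm_mul, Real.norm_eq_abs, Real.norm_eq_abs, Real.norm_eq_abs, hE,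
      Real.abs_exp, Real.abs_exp]
    calc _ ≤ Real.exp (-(4 * N * Real.sinh s ^ 2)) * (Real.exp (2 * s) *
          (C * (N⁻¹ * Real.exp (2 * s)) ^ M)) := by gcongr
      _ = _ := by rw [mul_pow]; ring
  · rw [integral_const_mul]
    have h2 := hD N hN
    rw [Finset.range_zero, Finset.sum_empty, sub_zero, pow_zero] at h2
    calc _ ≤ C * N⁻¹ ^ M * (D * (1 / √N)) := by
          gcongr
          exact (le_abs_self _).trans h2
      _ = _ := by ring

/-! ### Asymptotic series in n^{-1/2} and the exact order of b_n -/

lemma rpow_neg_half_eq (n m : ℕ) : (n : ℝ) ^ (-(m : ℝ) / 2) = (√(n : ℝ))⁻¹ ^ m := by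
  rw [inv_pow, Real.sqrt_eq_rpow, ← Real.rpow_mul_natCast (Nat.cast_nonneg n),
    ← Real.rpow_neg (Nat.cast_nonneg n)]
  congr 1
  ring

lemma hasAsymptoticSeries_of_bound {u : ℕ → ℂ} {g : ℕ → ℝ} {T : ℝ → ℂ} {σ : ℝ} {γ : ℕ → ℝ}
    (hu : ∀ n : ℕ, u (n + 1) / (g (n + 1) : ℂ) =
      ((2 / √Real.pi * √(√((n + 1 : ℕ) : ℝ)) : ℝ) : ℂ) * T √((n + 1 : ℕ) : ℝ))
    (hγ : ∀ m, γ m = σ ^ m * seriesCoeff m)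
    (h : ∀ M : ℕ, ∃ C : ℝ, 0 ≤ C ∧ ∀ N : ℝ, 1 ≤ N → ‖((2 / √Real.pi * √N : ℝ) : ℂ) * T N -
      ((∑ m ∈ Finset.range M, σ ^ m * seriesCoeff m * N⁻¹ ^ m : ℝ) : ℂ)‖ ≤ C * N⁻¹ ^ M) :
    HasAsymptoticSeries u g γ := by
  intro M
  obtain ⟨C, -, hC⟩ := h M
  refine Asymptotics.IsBigO.of_bound C ?_
  filter_upwards [Filter.eventually_ge_atTop 1] with n hn
  obtain ⟨n, rfl⟩ : ∃ k, n = k + 1 := ⟨n - 1, by omega⟩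
  have hN : 1 ≤ √((n + 1 : ℕ) : ℝ) := Real.one_le_sqrt.2 (by exact_mod_cast hn)
  simp only [hu, hγ, rpow_neg_half_eq]
  refine (hC _ hN).trans_eq ?_
  rw [Real.norm_eq_abs, abs_of_nonneg (by positivity)]

lemma rpow_three_quarters (n : ℕ) :
    (n : ℝ) ^ (3 / 4 : ℝ) = √(n : ℝ) * √(√(n : ℝ)) := by
  rw [Real.sqrt_eq_rpow, Real.sqrt_eq_rpow, ← Real.rpow_mul (Nat.cast_nonneg n),
    ← Real.rpow_add_of_nonneg (Nat.cast_nonneg n) (by norm_num) (by norm_num)]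
  norm_num

lemma a_hasAsymptoticSeries : HasAsymptoticSeries a
    (fun n : ℕ => Real.exp (2 * √(n : ℝ)) /
      (2 * (n : ℝ) ^ (3 / 4 : ℝ) * √(Real.pi * Real.exp 1))) c := by
  refine hasAsymptoticSeries_of_bound (T := circleSaddle) (σ := -1) (fun n => ?_) c_eq fun M =>
    exists_norm_sub_sum_seriesCoeff_le exists_abs_integral_weight_cos_sub_le
      (exists_norm_circleSaddle_sub_le M)
  set N := √((n + 1 : ℕ) : ℝ) with hNdef
  have hN : 1 ≤ N := Real.one_le_sqrt.2 (by push_cast; linarith [Nat.cast_nonneg (α := ℝ) n])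
  have hNpos : 0 < N := by linarith
  have hn : N ^ 2 = n + 1 := by rw [hNdef, Real.sq_sqrt (by positivity)]; push_cast; rfl
  have hpi0 : 0 < √Real.pi := Real.sqrt_pos.2 Real.pi_pos
  have hs0 : 0 < √N := Real.sqrt_pos.2 hNpos
  have he : √(Real.exp 1) = Real.exp (1 / 2) := by
    rw [Real.sqrt_eq_iff_mul_self_eq (by positivity) (by positivity), ← Real.exp_add]; norm_num
  rw [a_eq_integral n hN hn, rpow_three_quarters, ← hNdef, Real.sqrt_mul Real.pi_pos.le, he]
  change _ * circleSaddle N / _ = _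
  have hr : Real.exp (2 * N) * Real.exp (-(1 / 2)) / (Real.pi * N) =
      2 / √Real.pi * √N * (Real.exp (2 * N) / (2 * (N * √N) * (√Real.pi * Real.exp (1 / 2)))) := by
    rw [Real.exp_neg]
    field_simp
    rw [Real.sq_sqrt Real.pi_pos.le]
  have hc : (Complex.exp (2 * N) * Complex.exp (-(1 / 2)) / (Real.pi * N) : ℂ) =
      ((Real.exp (2 * N) * Real.exp (-(1 / 2)) / (Real.pi * N) : ℝ) : ℂ) := by
    push_cast
    rfl
  rw [hc, hr, mul_comm _ (circleSaddle N), mul_div_assoc, ← Complex.ofReal_div,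
    mul_div_cancel_right₀ _ (by positivity), mul_comm]

lemma b_hasAsymptoticSeries : HasAsymptoticSeries b
    (fun n : ℕ => -(√(Real.pi * Real.exp 1) /
      ((n : ℝ) ^ (3 / 4 : ℝ) * Real.exp (2 * √(n : ℝ)))))
    (fun m : ℕ => (-1) ^ m * c m) := by
  refine hasAsymptoticSeries_of_bound (T := fun N => (lineSaddle N : ℂ)) (σ := 1) (fun n => ?_)
    (fun m => ?_) fun M => exists_norm_sub_sum_seriesCoeff_le
      (A := fun ν N => ∫ s : ℝ, Real.exp (-(4 * N * Real.sinh s ^ 2)) * Real.exp (2 * ν * s))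
      (fun ν J => ?_) (exists_norm_lineSaddle_sub_le M)
  · set N := √((n + 1 : ℕ) : ℝ) with hNdef
    have hN : 1 ≤ N := Real.one_le_sqrt.2 (by push_cast; linarith [Nat.cast_nonneg (α := ℝ) n])
    have hNpos : 0 < N := by linarith
    have hn : N ^ 2 = n + 1 := by rw [hNdef, Real.sq_sqrt (by positivity)]; push_cast; rfl
    have hpi0 : 0 < √Real.pi := Real.sqrt_pos.2 Real.pi_pos
    have hs0 : 0 < √N := Real.sqrt_pos.2 hNpos
    have he : √(Real.exp 1) = Real.exp (1 / 2) := by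
      rw [Real.sqrt_eq_iff_mul_self_eq (by positivity) (by positivity), ← Real.exp_add]; norm_num
    rw [b_eq_integral n hNpos hn, rpow_three_quarters, ← hNdef, Real.sqrt_mul Real.pi_pos.le, he,
      ← Complex.ofReal_div, ← Complex.ofReal_mul]
    congr 1
    change -(_ * lineSaddle N) / _ = _
    rw [Real.exp_neg]
    field_simp
  · rw [c_eq, ← mul_assoc, ← mul_pow]
    norm_num
  · simpa only [one_pow, one_mul] using exists_abs_integral_weight_exp_sub_le ν J

lemma c_zero : c 0 = 1 := by
  simp [c_eq, seriesCoeff, besselCoeff_zero, expMuCoeff, maclaurinCoeff, μ]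

/-- The series truncated at M = 1, with c_0 = 1, shows that b_n divided by its prefactor tends to 1.
-/
lemma b_isTheta : b =Θ[Filter.atTop]
    (fun n : ℕ => Real.exp (-(2 * √(n : ℝ))) * (n : ℝ) ^ (-(3 / 4) : ℝ)) := by
  set g : ℕ → ℝ := fun n => -(√(Real.pi * Real.exp 1) /
      ((n : ℝ) ^ (3 / 4 : ℝ) * Real.exp (2 * √(n : ℝ)))) with hg
  have hK : 0 < √(Real.pi * Real.exp 1) := Real.sqrt_pos.2 (mul_pos Real.pi_pos (Real.exp_pos 1))
  have h1 := b_hasAsymptoticSeries 1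
  simp only [Finset.sum_range_one, pow_zero, one_mul, c_zero, Nat.cast_zero, neg_zero, zero_div,
    Real.rpow_zero, Nat.cast_one, Complex.ofReal_one] at h1
  have h2 : Filter.Tendsto (fun n : ℕ => (n : ℝ) ^ (-(1 : ℝ) / 2)) Filter.atTop (nhds 0) := by
    have := (tendsto_rpow_neg_atTop (y := 1 / 2) (by norm_num)).comp
      (tendsto_natCast_atTop_atTop (R := ℝ))
    refine this.congr fun n => ?_
    simp only [Function.comp_apply]
    norm_num
  have h3 : Filter.Tendsto (fun n => b n / (g n : ℂ)) Filter.atTop (nhds 1) := by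
    have := (h1.trans_tendsto h2).add_const 1
    simp only [sub_add_cancel, zero_add] at this
    exact this
  have hg0 : ∀ᶠ n in Filter.atTop, (g n : ℂ) ≠ 0 := by
    filter_upwards [Filter.eventually_gt_atTop 0] with n hn
    have hn' : (0 : ℝ) < n := by exact_mod_cast hn
    have : g n ≠ 0 := by
      rw [hg]
      exact neg_ne_zero.2 (by positivity)
    exact_mod_cast this
  have h4 : Asymptotics.IsEquivalent Filter.atTop b fun n => (g n : ℂ) :=
    (Asymptotics.isEquivalent_iff_tendsto_one hg0).2 h3
  have h5 : (fun n => (g n : ℂ)) =Θ[Filter.atTop]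
      (fun n : ℕ => Real.exp (-(2 * √(n : ℝ))) * (n : ℝ) ^ (-(3 / 4) : ℝ)) := by
    have e : ∀ n : ℕ, g n = -√(Real.pi * Real.exp 1) *
        (Real.exp (-(2 * √(n : ℝ))) * (n : ℝ) ^ (-(3 / 4) : ℝ)) := fun n => by
      rw [hg, Real.exp_neg, Real.rpow_neg (Nat.cast_nonneg n)]
      simp only [div_eq_mul_inv, mul_inv]
      ring
    have h6 : (fun n => (g n : ℂ)) =Θ[Filter.atTop] g :=
      Asymptotics.IsTheta.of_norm_eventuallyEq_norm
        (Filter.Eventually.of_forall fun n => Complex.norm_real _)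
    refine h6.trans ?_
    rw [funext e]
    exact (Asymptotics.isTheta_const_mul_left (neg_ne_zero.2 hK.ne')).2 (Asymptotics.isTheta_refl _ _)
  exact h4.isTheta.trans h5

end StretchedExp

theorem theorem1 :
    StretchedExp.HasAsymptoticSeries StretchedExp.a
      (fun n : ℕ => Real.exp (2 * √(n : ℝ)) /
        (2 * (n : ℝ) ^ (3 / 4 : ℝ) * √(Real.pi * Real.exp 1)))
      StretchedExp.c ∧
    StretchedExp.HasAsymptoticSeries StretchedExp.b
      (fun n : ℕ => -(√(Real.pi * Real.exp 1) /
        ((n : ℝ) ^ (3 / 4 : ℝ) * Real.exp (2 * √(n : ℝ)))))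
      (fun m : ℕ => (-1) ^ m * StretchedExp.c m) ∧
    StretchedExp.b =Θ[Filter.atTop]
      (fun n : ℕ => Real.exp (-(2 * √(n : ℝ))) * (n : ℝ) ^ (-(3 / 4) : ℝ)) :=
  ⟨StretchedExp.a_hasAsymptoticSeries, StretchedExp.b_hasAsymptoticSeries, StretchedExp.b_isTheta⟩
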